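/- Let $(G,\Omega)$ be an oligomorphic group: a group $G$ acting on a set $\Omega$ with finitely many orbits on $\Omega^n$ for all $n\ge 0$. For a finite subset $A\subset\Omega$ let $G(A)$ (resp. $G[A]$) be the subgroup of $G$ fixing $A$ pointwise (resp. setwise). An *$\mathscr{E}(\Omega)$-smooth $G$-set* is a set with a $G$-action that has finitely many orbits and in which every point stabilizer is of the form $G(A)$ with $A\subset\Omega$ finite; transitive $G$-sets are non-empty. A *measure* for $(G,\Omega)$ with values in a commutative ring $k$ assigns to each map $f\colon Y\to X$ of $\mathscr{E}(\Omega)$-smooth $G$-sets with $X$ transitive an element $\mu(f)\in k$ such that: (a) $\mu(f)=1$ if $f$ is an isomorphism; (b) $\mu(f)=\mu(f|_{Y_1})+\mu(f|_{Y_2})$ if $Y=Y_1\sqcup Y_2$ as $G$-sets; (c) $\mu(f\circ g)=\mu(f)\mu(g)$ for composable maps of transitive $\mathscr{E}(\Omega)$-smooth $G$-sets; (d) $\mu(f)=\mu(f')$ if $f'$ is the base change of $f$ along a map $X'\to X$ of transitive $\mathscr{E}(\Omega)$-smooth $G$-sets. The measure is *regular* if $\mu(f)$ is a unit of $k$ for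 every map $f$ of transitive $\mathscr{E}(\Omega)$-smooth $G$-sets. Let $\Theta(G,\Omega)$ be the ring carrying the universal measure: the quotient of the polynomial ring over $\mathbf{Z}$ in symbols $[f]$ by the ideal generated by the relations (a)–(d). Let $\Theta_{\le 1}(G,\Omega)$ be its additive subgroup generated by the classes $[f]$ of the maps $f\colon Y\to X$ where, for some $\ell\ge 0$, $Y$ is an orbit on $\Omega^{\ell+1}$, $X$ is an orbit on $\Omega^{\ell}$, and $f$ is the restriction of the projection onto the first $\ell$ factors. Assume: * $\mathrm{GEN}(1)$: $\Theta_{\le 1}(G,\Omega)$ is a finitely generated $\mathbf{Z}$-module; * $\mathrm{IND}(1)$: $G(A)=G[A]$ for every finite $A\subset\Omega$; * $(G,\Omega)$ is odd: whenever $Y\to X$ and $Z\to X$ are maps of transitive $\mathscr{E}(\Omega)$-smooth $G$-sets, the fiber product $Y\times_X Z$ has an odd number of $G$-orbits. Then there is a unique regular $\mathbf{Z}$-valued measure $\mu$ for $(G,\Omega)$. If $f\colon Y\to X$ is a map of transitive $\mathscr{E}(\Omega)$-smooth $G$-sets, and $Y^{(2)}_{/X}$ denotes the $G$-set of two-element subsets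 of $Y$ that are contained in a fiber of $f$, then the number $n$ of $G$-orbits on $Y^{(2)}_{/X}$ is finite and $\mu(f)=(-1)^n$. -/

import Mathlib

universe u

open scoped Pointwise

namespace Oligo

section General

variable {G : Type u} [Group G]

/-- An `E`-smooth `G`-set, for a class `E` of subgroups of `G`: a set with an action of `G` that has
finitely many orbits and all of whose point stabilizers belong to `E`. -/
structure GSet (E : Set (Subgroup G)) : Type (u + 1) where
  carrier : Type u
  [action : MulAction G carrier]
  finitary : Finite (MulAction.orbitRel.Quotient G carrier)
  smooth : ∀ x : carrier, MulAction.stabilizer G x ∈ E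

instance (E : Set (Subgroup G)) : CoeSort (GSet E) (Type u) := ⟨GSet.carrier⟩

instance {E : Set (Subgroup G)} (X : GSet E) : MulAction G X := X.action

variable {E : Set (Subgroup G)}

/-- A `G`-set is transitive if it consists of exactly one orbit (so it is non-empty). -/
def GSet.IsTransitive (X : GSet E) : Prop :=
  Nonempty X ∧ MulAction.IsPretransitive G X

/-- `Y` is the disjoint union of (the images of) `Y₁` and `Y₂`. -/
def IsDisjointUnion {Y Y₁ Y₂ : GSet E} (i₁ : Y₁ →[G] Y) (i₂ : Y₂ →[G] Y) : Prop :=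
  Function.Injective i₁ ∧ Function.Injective i₂ ∧ IsCompl (Set.range i₁) (Set.range i₂)

/-- The fiber product `Y ×_X Z`, as a `G`-stable subset of `Y × Z`. -/
def fiberProduct {X Y Z : GSet E} (f : Y →[G] X) (g : Z →[G] X) : SubMulAction G (Y × Z) where
  carrier := {p | f p.1 = g p.2}
  smul_mem' := by
    intro c p hp
    change f (c • p.1) = g (c • p.2)
    rw [map_smul, map_smul, show f p.1 = g p.2 from hp]

/-- The square with sides `g' : Y' → Y`, `f' : Y' → X'`, `f : Y → X`, `g : X' → X` is cartesian:
`(g', f')` is a bijection from `Y'` onto the fiber product `Y ×_X X'`. In other words,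
`f'` is the base change of `f` along `g`. -/
def IsBaseChange {X Y X' Y' : GSet E} (f : Y →[G] X) (g : X' →[G] X)
    (f' : Y' →[G] X') (g' : Y' →[G] Y) : Prop :=
  Function.Injective (fun y => (g' y, f' y)) ∧
    Set.range (fun y => (g' y, f' y)) = (fiberProduct f g : Set (Y × X'))

variable (E)

/-- A measure for `(G, E)` valued in the commutative ring `k`. -/
@[ext]
structure Measure (k : Type*) [CommRing k] where
  /-- the value `μ(f)` for a map `f : Y → X` of `E`-smooth `G`-sets with `X` transitive -/
  val : ∀ {Y X : GSet E}, X.IsTransitive → (Y →[G] X) → k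
  iso : ∀ {Y X : GSet E} (hX : X.IsTransitive) (f : Y →[G] X),
    Function.Bijective f → val hX f = 1
  add : ∀ {Y Y₁ Y₂ X : GSet E} (hX : X.IsTransitive) (f : Y →[G] X)
    (i₁ : Y₁ →[G] Y) (i₂ : Y₂ →[G] Y), IsDisjointUnion i₁ i₂ →
    val hX f = val hX (f.comp i₁) + val hX (f.comp i₂)
  comp : ∀ {Z Y X : GSet E} (_ : Z.IsTransitive) (hY : Y.IsTransitive) (hX : X.IsTransitive)
    (f : Y →[G] X) (g : Z →[G] Y), val hX (f.comp g) = val hX f * val hY g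
  baseChange : ∀ {X Y X' Y' : GSet E} (hX : X.IsTransitive) (hX' : X'.IsTransitive)
    (f : Y →[G] X) (g : X' →[G] X) (f' : Y' →[G] X') (g' : Y' →[G] Y),
    IsBaseChange f g f' g' → val hX f = val hX' f'

variable {E} in
/-- A measure is regular if its values on maps of transitive `E`-smooth `G`-sets are units. -/
def Measure.IsRegular {k : Type*} [CommRing k] (μ : Measure E k) : Prop :=
  ∀ {Y X : GSet E} (_ : Y.IsTransitive) (hX : X.IsTransitive) (f : Y →[G] X), IsUnit (μ.val hX f)

/-- The maps `f : Y → X` of `E`-smooth `G`-sets with `X` transitive. -/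
structure GMap : Type (u + 1) where
  {src : GSet E}
  {tgt : GSet E}
  transitive : tgt.IsTransitive
  hom : src →[G] tgt

variable {E} in
/-- The polynomial variable attached to a map `f : Y → X`. -/
noncomputable def symb {Y X : GSet E} (hX : X.IsTransitive) (f : Y →[G] X) :
    MvPolynomial (GMap E) ℤ :=
  MvPolynomial.X ⟨hX, f⟩

/-- The elements that generate the ideal of relations of `Θ(G, E)`. -/
inductive IsThetaRelation : MvPolynomial (GMap E) ℤ → Prop
  | iso {Y X : GSet E} (hX : X.IsTransitive) (f : Y →[G] X) :
      Function.Bijective f → IsThetaRelation (symb hX f - 1)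
  | add {Y Y₁ Y₂ X : GSet E} (hX : X.IsTransitive) (f : Y →[G] X)
      (i₁ : Y₁ →[G] Y) (i₂ : Y₂ →[G] Y) : IsDisjointUnion i₁ i₂ →
      IsThetaRelation (symb hX f - (symb hX (f.comp i₁) + symb hX (f.comp i₂)))
  | comp {Z Y X : GSet E} (hZ : Z.IsTransitive) (hY : Y.IsTransitive) (hX : X.IsTransitive)
      (f : Y →[G] X) (g : Z →[G] Y) :
      IsThetaRelation (symb hX (f.comp g) - symb hX f * symb hY g)
  | baseChange {X Y X' Y' : GSet E} (hX : X.IsTransitive) (hX' : X'.IsTransitive)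
      (f : Y →[G] X) (g : X' →[G] X) (f' : Y' →[G] X') (g' : Y' →[G] Y) :
      IsBaseChange f g f' g' → IsThetaRelation (symb hX f - symb hX' f')

/-- The ideal of relations of `Θ(G, E)`. -/
noncomputable def thetaIdeal : Ideal (MvPolynomial (GMap E) ℤ) :=
  Ideal.span {p | IsThetaRelation E p}

/-- The ring `Θ(G, E)` that carries the universal measure. -/
abbrev Theta : Type (u + 1) :=
  MvPolynomial (GMap E) ℤ ⧸ thetaIdeal E

variable {E} in
/-- The class `[f]` in `Θ(G, E)`. -/
noncomputable def Theta.cls {Y X : GSet E} (hX : X.IsTransitive) (f : Y →[G] X) : Theta E :=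
  Ideal.Quotient.mk (thetaIdeal E) (symb hX f)

variable {E} in
/-- `Y^{(2)}_{/X}`: the `G`-set of two-element subsets of `Y` contained in a fiber of `f : Y → X`
(the quotient by the symmetric group `𝔖₂` of `Y ×_X Y` minus its diagonal). -/
def fiberPairs {Y X : GSet E} (f : Y →[G] X) : SubMulAction G (Set Y) where
  carrier := {s | s.ncard = 2 ∧ ∀ y ∈ s, ∀ y' ∈ s, f y = f y'}
  smul_mem' := by
    rintro c s ⟨hs, h⟩
    refine ⟨by rw [Set.ncard_smul_set, hs], ?_⟩
    rintro _ ⟨y, hy, rfl⟩ _ ⟨y', hy', rfl⟩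
    simp only [map_smul]
    rw [h y hy y' hy']

end General

section Oligomorphic

variable (G Ω : Type u) [Group G] [MulAction G Ω]

/-- `(G, Ω)` is oligomorphic: `G` has finitely many orbits on `Ω^n` for all `n`. -/
def IsOligomorphic : Prop :=
  ∀ n : ℕ, Finite (MulAction.orbitRel.Quotient G (Fin n → Ω))

/-- The stabilizer class `ℰ(Ω)`: the subgroups `G(A)` with `A ⊆ Ω` finite. -/
def stabClass : Set (Subgroup G) :=
  {U | ∃ A : Finset Ω, U = fixingSubgroup G (A : Set Ω)}

/-- `IND(m)`: for finite `A ⊆ Ω`, the index of `G(A)` in `G[A]` divides a power of `m`. -/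
def IND (m : ℕ) : Prop :=
  ∀ A : Finset Ω, ∃ k : ℕ,
    (fixingSubgroup G (A : Set Ω)).relIndex (MulAction.stabilizer G (A : Set Ω)) ∣ m ^ k

/-- `(G, Ω)` is odd: fiber products of transitive `ℰ(Ω)`-smooth `G`-sets over transitive
`ℰ(Ω)`-smooth `G`-sets have an odd number of orbits. -/
def IsOdd : Prop :=
  ∀ {X Y Z : GSet (stabClass G Ω)}, X.IsTransitive → Y.IsTransitive → Z.IsTransitive →
    ∀ (f : Y →[G] X) (g : Z →[G] X),
      Odd (Nat.card (MulAction.orbitRel.Quotient G (fiberProduct f g)))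

variable {Ω}

/-- The orbit of a point of `Ω^n`, as an `ℰ(Ω)`-smooth `G`-set. -/
def orbitGSet {n : ℕ} (a : Fin n → Ω) : GSet (stabClass G Ω) where
  carrier := MulAction.orbit G a
  finitary := by
    have : Subsingleton (MulAction.orbitRel.Quotient G (MulAction.orbit G a)) :=
      (MulAction.pretransitive_iff_subsingleton_quotient G _).1 inferInstance
    infer_instance
  smooth := by
    classical
    rintro ⟨x, hx⟩
    refine ⟨Finset.univ.image x, ?_⟩
    ext g
    simp [MulAction.mem_stabilizer_iff, mem_fixingSubgroup_iff, Subtype.ext_iff, funext_iff]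

theorem orbitGSet_isTransitive {n : ℕ} (a : Fin n → Ω) : (orbitGSet G a).IsTransitive :=
  ⟨⟨⟨a, MulAction.mem_orbit_self a⟩⟩,
    inferInstanceAs (MulAction.IsPretransitive G (MulAction.orbit G a))⟩

/-- The basic map attached to `a ∈ Ω^{l+1}`: from the orbit `Y` of `a` to the orbit `X` on `Ω^l` of
its first `l` coordinates, the restriction of the projection onto the first `l` factors. -/
def basicMap {l : ℕ} (a : Fin (l + 1) → Ω) : orbitGSet G a →[G] orbitGSet G (Fin.init a) where
  toFun y := ⟨Fin.init y.1, by
    obtain ⟨_, g, rfl⟩ := y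
    exact ⟨g, rfl⟩⟩
  map_smul' _ _ := rfl

variable (Ω)

/-- `Θ_{≤ 1}(G, Ω)`: the additive subgroup of `Θ(G, Ω)` generated by the classes of basic maps. -/
noncomputable def ThetaLEOne : Submodule ℤ (Theta (stabClass G Ω)) :=
  Submodule.span ℤ {x | ∃ (l : ℕ) (a : Fin (l + 1) → Ω),
    x = Theta.cls (orbitGSet_isTransitive G (Fin.init a)) (basicMap G a)}

/-- `GEN(m)`: `Θ_{≤ 1}(G, Ω)[1/m]` is a finitely generated `ℤ[1/m]`-module. -/
def GEN (m : ℕ) : Prop :=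
  Module.Finite (Localization (Submonoid.powers (m : ℤ)))
    (LocalizedModule (Submonoid.powers (m : ℤ)) (ThetaLEOne G Ω))

end Oligomorphic

end Oligo

/-! Everything rests on the n-element subsets of the fibers of a map f : Y → X. By IND(1), an
element of G that preserves a finite subset of a smooth set fixes it pointwise
(`smul_eq_of_smul_set_eq`). So these subsets form a smooth set f^(n) over X, and counting flags
(point in a subset) gives n! μ(f^(n)) = μ(f)(μ(f) - 1)⋯(μ(f) - n + 1) for every measure μ
(`Measure.val_subsets_succ`).

Formula and uniqueness: let μ be regular with values in ℤ. If μ(f) is 1 or -1, the case n = 2 forces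
μ(f^(2)) to be 0 or 1. But μ(f^(2)) is a sum of signs, one for each orbit of f^(2), so its parity is
that of the number of orbits.

Existence: oddness says that counting orbits modulo 2 is a measure (`parityMeasure`). A measure
modulo an even n lifts to one modulo 2n by the Adams-type operation μ(f)² - 2μ(f^(2)). This is well
defined modulo 2n and reduces to μ(f), since 2μ(f^(2)) = μ(f)² - μ(f) (`Measure.lift`). In the limit
there is a 2-adic measure, with odd values on maps of transitive sets.

These values must be shown to be ±1. A map of transitive sets factors into maps that fix one more
point of Ω, so basic maps suffice. If f is basic with value u, each orbit of f^(n+1) has value u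
times a product of n basic values. Cancelling u gives (n+1)! s = (u - 1)⋯(u - n), with s an integral
combination of such products (`Measure.exists_factorial_mul_eq`). For n = 1 this says that the group
generated by the basic values in ℚ₂/ℤ is 2-divisible; by GEN(1) and Nakayama it is killed by an odd
integer, so the basic values are rational with a common denominator. For n = p - 1 the factor p! is
not a p-adic unit, which excludes both values of p-adic norm above 1 and values of norm below 1
(`padicNorm_eq_one_of_factorial_mul_eq`). A rational that is a unit at every prime is ±1. -/

namespace Oligo

open MulAction

/-! ### Orbit spaces and equivariant maps -/

section Orbits

variable {G : Type*} [Group G] {A B C : Type*} [MulAction G A] [MulAction G B] [MulAction G C]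

/-- The orbit of a point, as an element of the orbit space. -/
abbrev orbitClass (a : A) : orbitRel.Quotient G A := Quotient.mk'' a

theorem orbitClass_eq_iff {a b : A} :
    (orbitClass a : orbitRel.Quotient G A) = orbitClass b ↔ ∃ g : G, g • b = a := by
  rw [orbitClass, orbitClass, Quotient.eq'']
  rfl

theorem orbitClass_smul (g : G) (a : A) :
    (orbitClass (g • a) : orbitRel.Quotient G A) = orbitClass a :=
  orbitClass_eq_iff.2 ⟨g, rfl⟩

/-- The map of orbit spaces induced by an equivariant map. -/
def orbitMap (i : A →[G] B) : orbitRel.Quotient G A → orbitRel.Quotient G B :=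
  Quotient.map' i (by
    rintro a b ⟨g, rfl⟩
    exact ⟨g, (map_smul i g b).symm⟩)

theorem orbitMap_injective {i : A →[G] B} (hi : Function.Injective i) :
    Function.Injective (orbitMap i) := by
  intro p q
  induction p using Quotient.inductionOn' with | h a => ?_
  induction q using Quotient.inductionOn' with | h b => ?_
  intro h
  obtain ⟨g, hg⟩ := orbitClass_eq_iff.1 (show orbitClass (i a) = orbitClass (i b) from h)
  exact orbitClass_eq_iff.2 ⟨g, hi (by rw [map_smul, hg])⟩

theorem orbitMap_surjective {i : A →[G] B} (hi : Function.Surjective i) :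
    Function.Surjective (orbitMap i) := by
  intro q
  induction q using Quotient.inductionOn' with | h b => ?_
  obtain ⟨a, rfl⟩ := hi b
  exact ⟨orbitClass a, rfl⟩

theorem orbitMap_bijective {i : A →[G] B} (hi : Function.Bijective i) :
    Function.Bijective (orbitMap i) :=
  ⟨orbitMap_injective hi.1, orbitMap_surjective hi.2⟩

theorem exists_smul_eq_of_stabilizer_le [IsPretransitive G A] {a : A} {b : B}
    (h : stabilizer G a ≤ stabilizer G b) : ∃ i : A →[G] B, i a = b := by
  have key : ∀ g g' : G, g • a = g' • a → g • b = g' • b := by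
    intro g g' hg
    have : g'⁻¹ * g ∈ stabilizer G b := h (by
      rw [mem_stabilizer_iff, mul_smul, hg, inv_smul_smul])
    rw [mem_stabilizer_iff, mul_smul, inv_smul_eq_iff] at this
    exact this
  choose t ht using fun x : A => exists_smul_eq G a x
  refine ⟨⟨fun x => t x • b, fun g x => ?_⟩, ?_⟩
  · change _ = g • t x • b
    rw [← mul_smul]
    apply key
    rw [ht, mul_smul, ht]
  · change t a • b = b
    rw [key (t a) 1 (by rw [ht, one_smul]), one_smul]

end Orbits

/-! ### Stable subsets of smooth sets -/

variable {G : Type u} [Group G] {E : Set (Subgroup G)}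

instance (X : GSet E) : Finite (orbitRel.Quotient G X) := X.finitary

/-- A stable subset of an `E`-smooth `G`-set. -/
def GSet.sub (Y : GSet E) (S : SubMulAction G Y) : GSet E where
  carrier := S
  finitary := Finite.of_injective (orbitMap S.subtype) (orbitMap_injective Subtype.val_injective)
  smooth x := by
    rw [SubMulAction.stabilizer_of_subMul]
    exact Y.smooth x.1

/-- The inclusion of a stable subset. -/
def GSet.incl (Y : GSet E) (S : SubMulAction G Y) : Y.sub S →[G] Y := S.subtype

theorem GSet.incl_injective (Y : GSet E) (S : SubMulAction G Y) :
    Function.Injective (Y.incl S) := Subtype.val_injective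

/-- An equivariant map with values in a stable subset. -/
def GSet.corestrict {P Y : GSet E} (h : P →[G] Y) (S : SubMulAction G Y) (hS : ∀ p, h p ∈ S) :
    P →[G] Y.sub S where
  toFun p := ⟨h p, hS p⟩
  map_smul' g p := Subtype.ext (map_smul h g p)

/-- The preimage of a stable subset. -/
def preimageSub {P Y : GSet E} (h : P →[G] Y) (S : SubMulAction G Y) : SubMulAction G P where
  carrier := {p | h p ∈ S}
  smul_mem' g p hp := by
    change h (g • p) ∈ S
    rw [map_smul]
    exact S.smul_mem g hp

/-- The complement of a stable subset. -/
def complSub {Y : GSet E} (S : SubMulAction G Y) : SubMulAction G Y where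
  carrier := {y | y ∉ S}
  smul_mem' g y hy := by
    intro h
    apply hy
    have := S.smul_mem g⁻¹ h
    rwa [inv_smul_smul] at this

/-- The range of an equivariant map. -/
def rangeSub {P Y : GSet E} (h : P →[G] Y) : SubMulAction G Y where
  carrier := Set.range h
  smul_mem' := by
    rintro g _ ⟨p, rfl⟩
    exact ⟨g • p, map_smul h g p⟩

/-- The points of a given orbit. -/
def orbitSub {Y : GSet E} (q : orbitRel.Quotient G Y) : SubMulAction G Y where
  carrier := {y | orbitClass y = q}
  smul_mem' g y hy := by
    change orbitClass (g • y) = q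
    rw [orbitClass_smul]
    exact hy

/-- An orbit of an `E`-smooth `G`-set. -/
abbrev GSet.orb (Y : GSet E) (q : orbitRel.Quotient G Y) : GSet E := Y.sub (orbitSub q)

theorem GSet.orb_isTransitive (Y : GSet E) (q : orbitRel.Quotient G Y) :
    (Y.orb q).IsTransitive := by
  refine ⟨?_, ⟨?_⟩⟩
  · induction q using Quotient.inductionOn' with | h y => exact ⟨⟨y, rfl⟩⟩
  · rintro ⟨x, hx⟩ ⟨y, hy⟩
    obtain ⟨g, hg⟩ := orbitClass_eq_iff.1 ((show orbitClass y = q from hy).trans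
      (show orbitClass x = q from hx).symm)
    exact ⟨g, Subtype.ext hg⟩

theorem IsDisjointUnion.of_compl {Y Y₁ : GSet E} {i₁ : Y₁ →[G] Y} (h : Function.Injective i₁)
    {S : SubMulAction G Y} (hS : ∀ y, y ∈ S ↔ y ∉ Set.range i₁) :
    IsDisjointUnion i₁ (Y.incl S) := by
  refine ⟨h, Y.incl_injective S, ?_⟩
  have : Set.range (Y.incl S) = (Set.range i₁)ᶜ := by
    ext y
    rw [Set.mem_compl_iff, ← hS]
    exact ⟨by rintro ⟨x, rfl⟩; exact x.2, fun h => ⟨⟨y, h⟩, rfl⟩⟩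
  rw [this]
  exact isCompl_compl

/-! ### Additive functions and decomposition into orbits -/

section Additive

variable {X : GSet E} {k : Type*} [AddCommGroup k]

/-- A function on `G`-sets over `X` that is additive for disjoint unions. -/
def IsAdditive (v : ∀ Y : GSet E, (Y →[G] X) → k) : Prop :=
  ∀ (Y Y₁ Y₂ : GSet E) (f : Y →[G] X) (i₁ : Y₁ →[G] Y) (i₂ : Y₂ →[G] Y),
    IsDisjointUnion i₁ i₂ → v Y f = v Y₁ (f.comp i₁) + v Y₂ (f.comp i₂)

variable {v : ∀ Y : GSet E, (Y →[G] X) → k} (hv : IsAdditive v)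
include hv

/-- An empty set is the disjoint union of two copies of itself. -/
theorem IsAdditive.eq_zero {Y : GSet E} [IsEmpty Y] (f : Y →[G] X) : v Y f = 0 := by
  have := hv Y Y Y f (MulActionHom.id G) (MulActionHom.id G)
    ⟨fun x => isEmptyElim x, fun x => isEmptyElim x,
      Set.disjoint_left.2 fun x => isEmptyElim x,
      codisjoint_iff.2 (Set.ext fun x => isEmptyElim x)⟩
  simpa using this

theorem IsAdditive.congr {Y Y' : GSet E} (f : Y →[G] X) (i : Y' →[G] Y)
    (hi : Function.Bijective i) : v Y f = v Y' (f.comp i) := by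
  have h := hv Y Y' (Y.sub ⊥) f i (Y.incl ⊥) (IsDisjointUnion.of_compl hi.1 (fun y => by
    simp [hi.2.range_eq]
    exact fun h => h))
  have : IsEmpty (Y.sub ⊥) := ⟨fun x => x.2⟩
  rwa [hv.eq_zero (Y := Y.sub ⊥), add_zero] at h

theorem IsAdditive.sum {ι : Type*} [Fintype ι] {Y : GSet E} (f : Y →[G] X) (P : ι → GSet E)
    (i : ∀ a, P a →[G] Y) (hi : ∀ a, Function.Injective (i a))
    (h : ∀ y, ∃! a, y ∈ Set.range (i a)) : v Y f = ∑ a, v (P a) (f.comp (i a)) := by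
  classical
  let S : Finset ι → SubMulAction G Y := fun s =>
    { carrier := {y | ∃ a ∈ s, y ∈ Set.range (i a)}
      smul_mem' := by
        rintro g _ ⟨a, ha, p, rfl⟩
        exact ⟨a, ha, g • p, map_smul (i a) g p⟩ }
  have key : ∀ s : Finset ι, v (Y.sub (S s)) (f.comp (Y.incl (S s))) =
      ∑ a ∈ s, v (P a) (f.comp (i a)) := by
    intro s
    induction s using Finset.induction_on with
    | empty =>
      have : IsEmpty (Y.sub (S ∅)) := ⟨fun ⟨x, a, ha, _⟩ => by simp at ha⟩
      rw [hv.eq_zero, Finset.sum_empty]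
    | insert a s ha ih =>
      rw [Finset.sum_insert ha, ← ih]
      let j₁ : P a →[G] Y.sub (S (insert a s)) :=
        GSet.corestrict (i a) _ fun p => ⟨a, Finset.mem_insert_self a s, p, rfl⟩
      let j₂ : Y.sub (S s) →[G] Y.sub (S (insert a s)) :=
        GSet.corestrict (Y.incl (S s)) _ fun p => by
          obtain ⟨y, b, hb, hy⟩ := p
          exact ⟨b, Finset.mem_insert_of_mem hb, hy⟩
      refine hv _ _ _ _ j₁ j₂ ⟨?_, ?_, ?_⟩
      · intro p q hpq
        exact hi a (congrArg Subtype.val hpq)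
      · intro p q hpq
        exact Subtype.ext (congrArg (fun x => x.1) hpq)
      · constructor
        · rw [Set.disjoint_left]
          rintro _ ⟨p, rfl⟩ ⟨⟨q, b, hb, hq⟩, hpq⟩
          have hq' : q = i a p := congrArg Subtype.val hpq
          have := (h q).unique hq ⟨p, hq'.symm⟩
          exact ha (this ▸ hb)
        · rw [codisjoint_iff, eq_top_iff]
          rintro ⟨y, b, hb, hy⟩ -
          rcases Finset.mem_insert.1 hb with rfl | hb
          · obtain ⟨p, hp⟩ := hy
            exact Or.inl ⟨p, Subtype.ext hp⟩
          · exact Or.inr ⟨⟨y, b, hb, hy⟩, rfl⟩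
  rw [← key Finset.univ]
  apply hv.congr
  refine ⟨Y.incl_injective _, fun y => ⟨⟨y, ?_⟩, rfl⟩⟩
  obtain ⟨a, ha, -⟩ := h y
  exact ⟨a, Finset.mem_univ a, ha⟩

theorem IsAdditive.sum_preimage {Y Z : GSet E} [Fintype (orbitRel.Quotient G Z)] (f : Y →[G] X)
    (h : Y →[G] Z) : v Y f = ∑ q : orbitRel.Quotient G Z,
      v (Y.sub (preimageSub h (orbitSub q))) (f.comp (Y.incl (preimageSub h (orbitSub q)))) := by
  refine hv.sum f _ (fun q => Y.incl (preimageSub h (orbitSub q))) (fun q => Y.incl_injective _) ?_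
  intro y
  refine ⟨orbitClass (h y), ⟨⟨y, rfl⟩, rfl⟩, ?_⟩
  rintro q ⟨⟨y', hy'⟩, rfl⟩
  exact hy'.symm

theorem IsAdditive.sum_orb {Y : GSet E} [Fintype (orbitRel.Quotient G Y)] (f : Y →[G] X) :
    v Y f = ∑ q : orbitRel.Quotient G Y, v (Y.orb q) (f.comp (Y.incl (orbitSub q))) :=
  hv.sum_preimage f (MulActionHom.id G)

end Additive

/-! ### Formal consequences of the axioms of a measure -/

namespace Measure

variable {k : Type*} [CommRing k] (μ : Measure E k)

theorem isAdditive {X : GSet E} (hX : X.IsTransitive) :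
    IsAdditive (fun (Y : GSet E) (f : Y →[G] X) => μ.val hX f) :=
  fun _ _ _ f i₁ i₂ h => μ.add hX f i₁ i₂ h

theorem congr {X Y Y' : GSet E} (hX : X.IsTransitive) (f : Y →[G] X) (i : Y' →[G] Y)
    (hi : Function.Bijective i) : μ.val hX f = μ.val hX (f.comp i) :=
  (μ.isAdditive hX).congr f i hi

/-- Splitting Z into orbits removes the transitivity of Z from the axiom on composites. -/
theorem comp_val {X Y Z : GSet E} (hY : Y.IsTransitive) (hX : X.IsTransitive) (f : Y →[G] X)
    (g : Z →[G] Y) : μ.val hX (f.comp g) = μ.val hX f * μ.val hY g := by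
  classical
  have := Fintype.ofFinite (orbitRel.Quotient G Z)
  rw [(μ.isAdditive hX).sum_orb, (μ.isAdditive hY).sum_orb, Finset.mul_sum]
  exact Finset.sum_congr rfl fun q _ =>
    μ.comp (Z.orb_isTransitive q) hY hX f (g.comp (Z.incl (orbitSub q)))

/-- The restriction of a map `h : P → Z` to the preimage of an orbit of `Z`. -/
def overOrbit {P Z : GSet E} (h : P →[G] Z) (q : orbitRel.Quotient G Z) :
    P.sub (preimageSub h (orbitSub q)) →[G] Z.orb q :=
  GSet.corestrict (h.comp (P.incl _)) _ fun p => p.2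

/-- A Fubini principle, used for the counts below: when the fibers of h have the same measure over
every orbit of Z, that measure factors out. -/
theorem val_comp_of_const {X P Z : GSet E} (hX : X.IsTransitive) (g : Z →[G] X) (h : P →[G] Z)
    (c : k) (hc : ∀ q, μ.val (Z.orb_isTransitive q) (overOrbit h q) = c) :
    μ.val hX (g.comp h) = c * μ.val hX g := by
  classical
  have := Fintype.ofFinite (orbitRel.Quotient G Z)
  rw [(μ.isAdditive hX).sum_preimage (g.comp h) h, (μ.isAdditive hX).sum_orb g, Finset.mul_sum]
  refine Finset.sum_congr rfl fun q _ => ?_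
  rw [mul_comm, ← hc q, ← μ.comp_val]
  rfl

theorem val_iso_congr {X X' Y Y' : GSet E} (hX : X.IsTransitive) (hX' : X'.IsTransitive)
    (f : Y →[G] X) (f' : Y' →[G] X') (i : Y' →[G] Y) (j : X' →[G] X) (hi : Function.Bijective i)
    (hj : Function.Bijective j) (h : ∀ y, f (i y) = j (f' y)) : μ.val hX f = μ.val hX' f' := by
  have h1 : f.comp i = j.comp f' := by
    ext y
    exact h y
  rw [μ.congr hX f i hi, h1, μ.comp_val hX' hX, μ.iso hX j hj, one_mul]

/-- The stabilizer of t fixes every point of the fiber over t, so each orbit of P meets that fiber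
once and maps isomorphically to T. Hence P is a sum of n copies of T. -/
theorem val_eq_of_sections {P T : GSet E} (hT : T.IsTransitive) (f : P →[G] T) (t : T) (n : ℕ)
    (hn : {p | f p = t}.encard = n) (h : ∀ p, f p = t → stabilizer G t ≤ stabilizer G p) :
    μ.val hT f = n := by
  classical
  have := Fintype.ofFinite (orbitRel.Quotient G P)
  have := hT.2
  have hmap : ∀ q : orbitRel.Quotient G P, ∃ p, f p = t ∧ orbitClass p = q := by
    intro q
    induction q using Quotient.inductionOn' with | h p => ?_
    obtain ⟨g, hg⟩ := exists_smul_eq G (f p) t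
    exact ⟨g • p, by rw [map_smul, hg], orbitClass_smul g p⟩
  have huniq : ∀ p p', f p = t → f p' = t → orbitClass (G := G) p = orbitClass p' → p = p' := by
    intro p p' hp hp' hpp
    obtain ⟨g, rfl⟩ := orbitClass_eq_iff.1 hpp
    have : g ∈ stabilizer G t := by
      rw [mem_stabilizer_iff]
      rw [map_smul, hp'] at hp
      exact hp
    exact h p' hp' this
  have hone : ∀ q : orbitRel.Quotient G P, μ.val hT (f.comp (P.incl (orbitSub q))) = 1 := by
    intro q
    apply μ.iso
    constructor
    · rintro ⟨p, hp⟩ ⟨p', hp'⟩ hpp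
      obtain ⟨g, hg⟩ := exists_smul_eq G (f p) t
      have hpp : f p = f p' := hpp
      have : g • p = g • p' := huniq _ _ (by rw [map_smul, hg]) (by rw [map_smul, ← hpp, hg]) (by
        rw [orbitClass_smul, orbitClass_smul]
        exact (show orbitClass p = q from hp).trans (show orbitClass p' = q from hp').symm)
      exact Subtype.ext (smul_left_cancel g this)
    · intro x
      obtain ⟨p, hp, hq⟩ := hmap q
      obtain ⟨g, hg⟩ := exists_smul_eq G t x
      refine ⟨⟨g • p, by exact (orbitClass_smul g p).trans hq⟩, ?_⟩
      change f (g • p) = x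
      rw [map_smul, hp, hg]
  rw [(μ.isAdditive hT).sum_orb, Finset.sum_congr rfl fun q _ => hone q]
  have hbij : Function.Bijective (fun p : {p | f p = t} => (orbitClass p.1 : orbitRel.Quotient G P)) :=
    ⟨fun p p' hpp => Subtype.ext (huniq _ _ p.2 p'.2 hpp), fun q => by
      obtain ⟨p, hp, hq⟩ := hmap q
      exact ⟨⟨p, hp⟩, hq⟩⟩
  have hcard : Nat.card {p | f p = t} = n := by
    rw [Nat.card_coe_set_eq, Set.ncard, hn]
    rfl
  rw [Finset.sum_const, Finset.card_univ, ← Nat.card_eq_fintype_card,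
    ← Nat.card_congr (Equiv.ofBijective _ hbij), hcard, nsmul_eq_mul, mul_one]

end Measure

end Oligo

/-! ### Products of smooth sets, and IND(1) for finite subsets of smooth sets -/

namespace Oligo

open MulAction

variable {G Ω : Type u} [Group G] [MulAction G Ω]

theorem inf_mem_stabClass {U V : Subgroup G} (hU : U ∈ stabClass G Ω) (hV : V ∈ stabClass G Ω) :
    U ⊓ V ∈ stabClass G Ω := by
  classical
  obtain ⟨A, rfl⟩ := hU
  obtain ⟨B, rfl⟩ := hV
  exact ⟨A ∪ B, by rw [Finset.coe_union, fixingSubgroup_union]⟩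

theorem exists_tuple_of_mem_stabClass {U : Subgroup G} (hU : U ∈ stabClass G Ω) :
    ∃ (n : ℕ) (a : Fin n → Ω), stabilizer G a = U := by
  obtain ⟨A, rfl⟩ := hU
  refine ⟨A.card, fun i => (A.equivFin.symm i : Ω), ?_⟩
  ext g
  rw [mem_stabilizer_iff, mem_fixingSubgroup_iff, funext_iff]
  constructor
  · intro h y hy
    simpa using h (A.equivFin ⟨y, hy⟩)
  · intro h i
    exact h _ (A.equivFin.symm i).2

/-- A point is encoded by its orbit and a tuple in Ω with the same stabilizer. The two orbits and
the orbit of the concatenated tuple then determine the orbit of a pair. -/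
theorem IsOligomorphic.finite_prod (hG : IsOligomorphic G Ω) (Y Z : GSet (stabClass G Ω)) :
    Finite (orbitRel.Quotient G (Y × Z)) := by
  -- The length of the tuple depends on the orbit, whence the casts between `Fin` types.
  have aux : ∀ Y : GSet (stabClass G Ω), ∃ (n : orbitRel.Quotient G Y → ℕ)
      (t : ∀ y : Y, Fin (n (orbitClass y)) → Ω), ∀ (y y' : Y) (g : G)
      (h : (orbitClass y' : orbitRel.Quotient G Y) = orbitClass y),
      (fun i => t y (Fin.cast (congrArg n h) i)) = g • t y' → y = g • y' := by
    intro Y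
    choose n a ha using fun q : orbitRel.Quotient G Y =>
      exists_tuple_of_mem_stabClass (Y.smooth (Quotient.out q))
    choose s hs using fun y : Y => orbitClass_eq_iff.1
      (show orbitClass y = orbitClass (Quotient.out (orbitClass y : orbitRel.Quotient G Y)) from
        (Quotient.out_eq' _).symm)
    refine ⟨n, fun y => s y • a (orbitClass y), fun y y' g h hy => ?_⟩
    have hy' : s y • a (orbitClass y) = g • s y' • a (orbitClass y) := by
      have key : ∀ (q q' : orbitRel.Quotient G Y) (e : q' = q) (c c' : G),
          (fun i => (c • a q) (Fin.cast (congrArg n e) i)) = c' • a q' → c • a q = c' • a q := by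
        rintro q _ rfl c c' h
        exact h
      rw [← mul_smul] at hy ⊢
      exact key _ _ h _ _ hy
    have hmem : (g * s y')⁻¹ * s y ∈ stabilizer G (a (orbitClass y)) := by
      rw [mem_stabilizer_iff, mul_smul, hy', ← mul_smul g, inv_smul_smul]
    rw [ha, mem_stabilizer_iff, mul_smul, hs, inv_smul_eq_iff, mul_smul] at hmem
    rw [hmem, ← h, hs]
  obtain ⟨n, t, ht⟩ := aux Y
  obtain ⟨m, r, hr⟩ := aux Z
  have := fun N => hG N
  let T : Type u := Σ p : orbitRel.Quotient G Y × orbitRel.Quotient G Z,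
    orbitRel.Quotient G (Fin (n p.1 + m p.2) → Ω)
  let F : orbitRel.Quotient G (Y × Z) → T := fun q =>
    ⟨(orbitClass (Quotient.out q).1, orbitClass (Quotient.out q).2),
      orbitClass (Fin.append (t (Quotient.out q).1) (r (Quotient.out q).2))⟩
  refine Finite.of_injective F fun q q' h => ?_
  have key : ∀ y y' : Y, ∀ z z' : Z,
      (⟨(orbitClass y, orbitClass z), orbitClass (Fin.append (t y) (r z))⟩ : T) =
        ⟨(orbitClass y', orbitClass z'), orbitClass (Fin.append (t y') (r z'))⟩ →
      (orbitClass (y, z) : orbitRel.Quotient G (Y × Z)) = orbitClass (y', z') := by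
    intro y y' z z' h
    have h1 : (orbitClass y' : orbitRel.Quotient G Y) = orbitClass y :=
      (congrArg (fun p : T => p.1.1) h).symm
    have h2 : (orbitClass z' : orbitRel.Quotient G Z) = orbitClass z :=
      (congrArg (fun p : T => p.1.2) h).symm
    have gen : ∀ (p p' : orbitRel.Quotient G Y × orbitRel.Quotient G Z) (e1 : p'.1 = p.1)
        (e2 : p'.2 = p.2)
        (a : Fin (n p.1) → Ω) (a' : Fin (n p'.1) → Ω) (b : Fin (m p.2) → Ω) (b' : Fin (m p'.2) → Ω),
        (⟨p, orbitClass (Fin.append a b)⟩ : T) = ⟨p', orbitClass (Fin.append a' b')⟩ →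
        ∃ g : G, (fun i => a (Fin.cast (congrArg n e1) i)) = g • a' ∧
          (fun i => b (Fin.cast (congrArg m e2) i)) = g • b' := by
      rintro ⟨p, q⟩ ⟨p', q'⟩ e1 e2 a a' b b' h
      obtain rfl : p' = p := e1
      obtain rfl : q' = q := e2
      obtain ⟨g, hg⟩ := orbitClass_eq_iff.1 (eq_of_heq (Sigma.mk.inj h).2)
      refine ⟨g, ?_, ?_⟩
      · funext i
        have := congrFun hg (Fin.castAdd _ i)
        simpa using this.symm
      · funext i
        have := congrFun hg (Fin.natAdd _ i)
        simpa using this.symm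
    obtain ⟨g, hg1, hg2⟩ := gen _ _ h1 h2 _ _ _ _ h
    refine orbitClass_eq_iff.2 ⟨g, ?_⟩
    rw [ht y y' g h1 hg1, hr z z' g h2 hg2]
    rfl
  have := key _ _ _ _ h
  rw [← Quotient.out_eq' q, ← Quotient.out_eq' q']
  exact this

/-- The product of two smooth `G`-sets. -/
def GSet.prod (hG : IsOligomorphic G Ω) (Y Z : GSet (stabClass G Ω)) :
    GSet (stabClass G Ω) where
  carrier := Y × Z
  finitary := hG.finite_prod Y Z
  smooth p := by
    have : stabilizer G p = stabilizer G p.1 ⊓ stabilizer G p.2 := by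
      ext g
      simp [mem_stabilizer_iff, Prod.ext_iff]
    rw [this]
    exact inf_mem_stabClass (Y.smooth _) (Z.smooth _)

/-- List A as a tuple a. If (a, ω) and (a, ω') are in one orbit, an element of G(A) moves ω' to ω;
as ω' is fixed, they agree. So there are no more fixed points than orbits of such tuples. -/
theorem finite_fixedPoints (hG : IsOligomorphic G Ω) (A : Finset Ω) :
    {ω : Ω | ∀ g ∈ fixingSubgroup G (A : Set Ω), g • ω = ω}.Finite := by
  obtain ⟨n, a, ha⟩ := exists_tuple_of_mem_stabClass (G := G) (Ω := Ω) ⟨A, rfl⟩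
  have := hG (n + 1)
  let F : {ω : Ω | ∀ g ∈ fixingSubgroup G (A : Set Ω), g • ω = ω} →
      orbitRel.Quotient G (Fin (n + 1) → Ω) := fun ω => orbitClass (Fin.snoc a ω.1 : Fin (n + 1) → Ω)
  refine Finite.of_injective F fun ω ω' h => ?_
  obtain ⟨g, hg⟩ := orbitClass_eq_iff.1 (show orbitClass _ = orbitClass _ from h)
  have h1 : g ∈ fixingSubgroup G (A : Set Ω) := by
    rw [← ha, mem_stabilizer_iff]
    funext i
    simpa using congrFun hg i.castSucc
  have h2 := congrFun hg (Fin.last n)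
  simp only [Pi.smul_apply, Fin.snoc_last] at h2
  exact Subtype.ext (h2.symm.trans (ω'.2 g h1))

/-- An element normalizing U = G(A) preserves the finite set C of fixed points of U, so it lies in
G[C] = G(C), which is contained in G(A) because A ⊆ C. -/
theorem mem_of_normalizes (hG : IsOligomorphic G Ω) (hIND : IND G Ω 1) {U : Subgroup G}
    (hU : U ∈ stabClass G Ω) {g : G} (hg : ∀ h, h ∈ U ↔ g * h * g⁻¹ ∈ U) : g ∈ U := by
  obtain ⟨A, rfl⟩ := hU
  obtain ⟨C, hC⟩ := (finite_fixedPoints hG A).exists_finset_coe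
  obtain ⟨k, hk⟩ := hIND C
  rw [one_pow, Nat.dvd_one, Subgroup.relIndex_eq_one] at hk
  have hmem : ∀ c : Ω, c ∈ (C : Set Ω) ↔ ∀ h ∈ fixingSubgroup G (A : Set Ω), h • c = c := by
    intro c
    rw [hC]
    rfl
  have hAC : (A : Set Ω) ⊆ C := fun c hc => (hmem c).2 fun h hh => hh ⟨c, hc⟩
  apply fixingSubgroup_antitone G Ω hAC
  apply hk
  rw [mem_stabilizer_iff]
  ext c
  rw [Set.mem_smul_set_iff_inv_smul_mem, hmem, hmem]
  constructor
  · intro hc h hh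
    have := hc (g⁻¹ * h * g) ((hg _).2 (by simpa [mul_assoc] using hh))
    rwa [mul_smul, smul_inv_smul, mul_smul, smul_left_cancel_iff] at this
  · intro hc h hh
    have := hc _ ((hg _).1 hh)
    rwa [mul_smul, mul_smul, smul_eq_iff_eq_inv_smul] at this

theorem fixingSubgroup_mem_stabClass (Y : GSet (stabClass G Ω)) {S : Set Y} (hS : S.Finite) :
    fixingSubgroup G S ∈ stabClass G Ω := by
  induction S, hS using Set.Finite.induction_on with
  | empty =>
    refine ⟨∅, ?_⟩
    ext g
    simp
  | @insert y S _ _ ih =>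
    have : fixingSubgroup G (insert y S) = stabilizer G y ⊓ fixingSubgroup G S := by
      ext g
      simp [mem_fixingSubgroup_iff]
    rw [this]
    exact inf_mem_stabClass (Y.smooth y) ih

/-- An element preserving S normalizes the pointwise stabilizer of S, which is again of the form
G(A). -/
theorem smul_eq_of_smul_set_eq (hG : IsOligomorphic G Ω) (hIND : IND G Ω 1)
    {Y : GSet (stabClass G Ω)} {S : Set Y} (hS : S.Finite) {g : G} (hg : g • S = S) :
    g ∈ fixingSubgroup G S := by
  refine mem_of_normalizes hG hIND (fixingSubgroup_mem_stabClass Y hS) fun h => ?_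
  simp only [mem_fixingSubgroup_iff]
  constructor
  · intro H y hy
    rw [← hg, Set.mem_smul_set_iff_inv_smul_mem] at hy
    rw [mul_smul, mul_smul, H _ hy, smul_inv_smul]
  · intro H y hy
    have hy' : g • y ∈ S := by
      rw [← hg]
      exact Set.smul_mem_smul_set hy
    have := H _ hy'
    rwa [mul_smul, mul_smul, inv_smul_smul, smul_left_cancel_iff] at this

/-- The pairs `(x, S)` where `S` is a set of `n` points in the fiber of `f` over `x`. -/
def fiberSubsets {Y X : GSet (stabClass G Ω)} (f : Y →[G] X) (n : ℕ) :
    SubMulAction G (X × Set Y) where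
  carrier := {p | p.2.encard = n ∧ ∀ y ∈ p.2, f y = p.1}
  smul_mem' := by
    rintro g ⟨x, S⟩ ⟨hS, h⟩
    refine ⟨by rw [← hS]; exact Set.encard_smul_set g S, ?_⟩
    rintro _ ⟨y, hy, rfl⟩
    change f (g • y) = g • x
    rw [map_smul, h y hy]

theorem stabilizer_fiberSubsets (hG : IsOligomorphic G Ω) (hIND : IND G Ω 1)
    {Y X : GSet (stabClass G Ω)} {f : Y →[G] X} {n : ℕ} (p : fiberSubsets f n) :
    stabilizer G p = stabilizer G p.1.1 ⊓ fixingSubgroup G p.1.2 := by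
  rw [SubMulAction.stabilizer_of_subMul]
  ext g
  rw [Subgroup.mem_inf, mem_stabilizer_iff, mem_stabilizer_iff, Prod.ext_iff]
  refine and_congr_right fun _ => ⟨fun h => smul_eq_of_smul_set_eq hG hIND
    (Set.finite_of_encard_eq_coe p.2.1) h, fun h => ?_⟩
  rw [mem_fixingSubgroup_iff] at h
  change g • p.1.2 = p.1.2
  rw [← Set.image_smul, Set.image_congr h, Set.image_id']

theorem mem_stabClass_fiberSubsets (hG : IsOligomorphic G Ω) (hIND : IND G Ω 1)
    {Y X : GSet (stabClass G Ω)} {f : Y →[G] X} {n : ℕ} (p : fiberSubsets f n) :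
    stabilizer G p ∈ stabClass G Ω := by
  rw [stabilizer_fiberSubsets hG hIND]
  exact inf_mem_stabClass (X.smooth _)
    (fixingSubgroup_mem_stabClass Y (Set.finite_of_encard_eq_coe p.2.1))

theorem encard_sdiff_singleton_of_encard_eq {α : Type*} {S : Set α} {n : ℕ}
    (hS : S.encard = (n + 1 : ℕ)) {y : α} (hy : y ∈ S) : (S \ {y}).encard = n := by
  have := Set.encard_sdiff_singleton_add_one hy
  rw [hS, Nat.cast_add, Nat.cast_one] at this
  exact ENat.add_left_injective_of_ne_top ENat.one_ne_top this

/-- Subsets of size n + 1 arise from subsets of size n by inserting a point, so they are an image of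
a stable part of a product of two smooth sets. -/
theorem finite_orbits_fiberSubsets (hG : IsOligomorphic G Ω) (hIND : IND G Ω 1)
    {Y X : GSet (stabClass G Ω)} (f : Y →[G] X) (n : ℕ) :
    Finite (orbitRel.Quotient G (fiberSubsets f n)) := by
  induction n with
  | zero =>
    let i : fiberSubsets f 0 →[G] X := ⟨fun p => p.1.1, fun _ _ => rfl⟩
    refine Finite.of_injective (orbitMap i) (orbitMap_injective ?_)
    rintro ⟨⟨x, S⟩, hS, _⟩ ⟨⟨x', S'⟩, hS', _⟩ h
    obtain rfl : x = x' := h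
    simp only [Nat.cast_zero, Set.encard_eq_zero] at hS hS'
    subst hS hS'
    rfl
  | succ n ih =>
    let P : GSet (stabClass G Ω) := ⟨fiberSubsets f n, ih, mem_stabClass_fiberSubsets hG hIND⟩
    let Q := (P.prod hG Y).sub
      { carrier := {p | f p.2 = p.1.1.1 ∧ p.2 ∉ p.1.1.2}
        smul_mem' := by
          rintro g ⟨p, y⟩ ⟨h1, h2⟩
          refine ⟨?_, ?_⟩
          · change f (g • y) = g • p.1.1
            rw [map_smul, h1]
          · change g • y ∉ g • p.1.2
            rwa [Set.smul_mem_smul_set_iff] }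
    let i : Q →[G] fiberSubsets f (n + 1) :=
      { toFun := fun p => ⟨(p.1.1.1.1, insert p.1.2 p.1.1.1.2), by
          refine ⟨?_, ?_⟩
          · change (insert p.1.2 p.1.1.1.2).encard = _
            rw [Set.encard_insert_of_notMem p.2.2, p.1.1.2.1]
            rfl
          · rintro y (rfl | hy)
            · exact p.2.1
            · exact p.1.1.2.2 y hy⟩
        map_smul' := fun g p => Subtype.ext (Prod.ext rfl (Set.image_insert_eq (f := (g • ·))).symm) }
    have hQ := Q.finitary
    refine @Finite.of_surjective _ _ hQ (orbitMap i) (orbitMap_surjective ?_)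
    rintro ⟨⟨x, S⟩, hS, h⟩
    have hne : S.Nonempty := by
      rw [← Set.encard_pos, hS]
      exact_mod_cast n.succ_pos
    obtain ⟨y, hy⟩ := hne
    refine ⟨⟨(⟨(x, S \ {y}), ?_, fun z hz => h z hz.1⟩, y), h y hy, fun hh => hh.2 rfl⟩, ?_⟩
    · exact encard_sdiff_singleton_of_encard_eq hS hy
    · exact Subtype.ext (Prod.ext rfl (Set.insert_sdiff_self_of_mem hy))

end Oligo

/-! ### Fiber products and the measure of n-element subsets of fibers -/

namespace Oligo

open MulAction

variable {G Ω : Type u} [Group G] [MulAction G Ω]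

/-- The fiber product, as a smooth `G`-set. -/
def GSet.fib (hG : IsOligomorphic G Ω) {X Y Z : GSet (stabClass G Ω)} (f : Y →[G] X)
    (g : Z →[G] X) : GSet (stabClass G Ω) :=
  (Y.prod hG Z).sub (fiberProduct f g)

/-- The first projection of a fiber product. -/
def fibFst (hG : IsOligomorphic G Ω) {X Y Z : GSet (stabClass G Ω)} (f : Y →[G] X)
    (g : Z →[G] X) : GSet.fib hG f g →[G] Y where
  toFun p := p.1.1
  map_smul' _ _ := rfl

/-- The second projection of a fiber product. -/
def fibSnd (hG : IsOligomorphic G Ω) {X Y Z : GSet (stabClass G Ω)} (f : Y →[G] X)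
    (g : Z →[G] X) : GSet.fib hG f g →[G] Z where
  toFun p := p.1.2
  map_smul' _ _ := rfl

theorem isBaseChange_fib (hG : IsOligomorphic G Ω) {X Y Z : GSet (stabClass G Ω)} (f : Y →[G] X)
    (g : Z →[G] X) : IsBaseChange f g (fibSnd hG f g) (fibFst hG f g) :=
  ⟨fun _ _ h => Subtype.ext h, Subtype.range_coe⟩

theorem isBaseChange_overOrbit (hG : IsOligomorphic G Ω) {X Y Z : GSet (stabClass G Ω)}
    (f : Y →[G] X) (g : Z →[G] X) (q : orbitRel.Quotient G Z) :
    IsBaseChange f (g.comp (Z.incl (orbitSub q))) (Measure.overOrbit (fibSnd hG f g) q)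
      ((fibFst hG f g).comp (GSet.incl _ _)) := by
  constructor
  · intro a b h
    have h1 := congrArg (fun p => p.1) h
    have h2 := congrArg (fun p => p.2.1) h
    exact Subtype.ext (Subtype.ext (Prod.ext h1 h2))
  · ext ⟨y, z⟩
    constructor
    · rintro ⟨a, h⟩
      rw [← h]
      exact a.1.2
    · intro h
      exact ⟨⟨⟨(y, z.1), h⟩, z.2⟩, rfl⟩

section Subsets

variable (hG : IsOligomorphic G Ω) (hIND : IND G Ω 1) {X Y : GSet (stabClass G Ω)} (f : Y →[G] X)

/-- The smooth `G`-set of `n`-element subsets of the fibers of `f`. -/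
def GSet.subsets (n : ℕ) : GSet (stabClass G Ω) where
  carrier := fiberSubsets f n
  finitary := finite_orbits_fiberSubsets hG hIND f n
  smooth := mem_stabClass_fiberSubsets hG hIND

/-- The projection from the `n`-element subsets of the fibers of `f` to the base. -/
def subsetsProj (n : ℕ) : GSet.subsets hG hIND f n →[G] X where
  toFun p := p.1.1
  map_smul' _ _ := rfl

/-- The pairs `(S, y)` with `y ∈ S` inside the fiber product of `n`-element subsets and points. -/
def flagSub (n : ℕ) : SubMulAction G (GSet.fib hG (subsetsProj hG hIND f n) f) where
  carrier := {p | p.1.2 ∈ p.1.1.1.2}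
  smul_mem' _ _ h := Set.smul_mem_smul_set h

variable {f} in
theorem mem_fixing_of_mem_stabilizer {n : ℕ} {p : GSet.subsets hG hIND f n} {g : G}
    (hg : g ∈ stabilizer G p) {y : Y} (hy : y ∈ p.1.2) : g • y = y := by
  have : g ∈ stabilizer G p.1.1 ⊓ fixingSubgroup G p.1.2 :=
    stabilizer_fiberSubsets hG hIND (f := f) p ▸ hg
  exact (mem_fixingSubgroup_iff G).1 this.2 y hy

variable {k : Type*} [CommRing k] (μ : Measure (stabClass G Ω) k) (hX : X.IsTransitive)

theorem Measure.val_fib {Z : GSet (stabClass G Ω)} (g : Z →[G] X) :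
    μ.val hX (g.comp (fibSnd hG f g)) = μ.val hX f * μ.val hX g :=
  μ.val_comp_of_const hX g (fibSnd hG f g) _ fun q =>
    (μ.baseChange hX (Z.orb_isTransitive q) f _ _ _ (isBaseChange_overOrbit hG f g q)).symm

/-- The stabilizer of a subset fixes each of its n points, so over every orbit of subsets the flags
are n disjoint sections. -/
theorem Measure.val_flag (n : ℕ) :
    μ.val hX (f.comp ((fibSnd hG (subsetsProj hG hIND f n) f).comp
      (GSet.incl _ (flagSub hG hIND f n)))) = n * μ.val hX (subsetsProj hG hIND f n) := by
  have hcomm : f.comp ((fibSnd hG (subsetsProj hG hIND f n) f).comp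
      (GSet.incl _ (flagSub hG hIND f n))) = (subsetsProj hG hIND f n).comp
        ((fibFst hG (subsetsProj hG hIND f n) f).comp (GSet.incl _ (flagSub hG hIND f n))) := by
    ext p
    exact p.1.2.symm
  rw [hcomm]
  refine μ.val_comp_of_const hX _ _ _ fun q => ?_
  obtain ⟨t⟩ := (GSet.orb_isTransitive _ q).1
  refine μ.val_eq_of_sections _ _ t n ?_ ?_
  · rw [← t.1.2.1]
    rw [← Set.InjOn.encard_image (f := fun p => p.1.1.1.2)]
    · congr 1
      ext y
      constructor
      · rintro ⟨p, hp, rfl⟩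
        have : p.1.1.1.1 = t.1 := congrArg Subtype.val hp
        rw [← this]
        exact p.1.2
      · intro hy
        exact ⟨⟨⟨⟨(t.1, y), (t.1.2.2 y hy).symm⟩, hy⟩, t.2⟩, rfl, rfl⟩
    · intro p hp p' hp' h
      have h1 : p.1.1.1.1 = p'.1.1.1.1 := congrArg Subtype.val (hp.trans hp'.symm)
      exact Subtype.ext (Subtype.ext (Subtype.ext (Prod.ext h1 h)))
  · rintro p rfl g hg
    have hg : g • _ = _ := hg
    have h1 : g • p.1.1.1.1 = p.1.1.1.1 := congrArg Subtype.val hg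
    have h2 : g • p.1.1.1.2 = p.1.1.1.2 :=
      mem_fixing_of_mem_stabilizer hG hIND (p := p.1.1.1.1) h1 p.1.2
    exact Subtype.ext (Subtype.ext (Subtype.ext (Prod.ext h1 h2)))

theorem Measure.val_subsets_zero : μ.val hX (subsetsProj hG hIND f 0) = 1 := by
  apply μ.iso
  constructor
  · rintro ⟨⟨x, S⟩, hS, _⟩ ⟨⟨x', S'⟩, hS', _⟩ h
    obtain rfl : x = x' := h
    simp only [Nat.cast_zero, Set.encard_eq_zero] at hS hS'
    subst hS hS'
    rfl
  · intro x
    exact ⟨⟨(x, ∅), Set.encard_empty, fun y hy => hy.elim⟩, rfl⟩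

/-- Adding a new point to an `n`-element subset of a fiber. -/
def insertMap (n : ℕ) : (GSet.fib hG (subsetsProj hG hIND f n) f).sub
    (complSub (flagSub hG hIND f n)) →[G] (GSet.fib hG (subsetsProj hG hIND f (n + 1)) f).sub
      (flagSub hG hIND f (n + 1)) where
  toFun p := ⟨⟨(⟨(p.1.1.1.1.1, insert p.1.1.2 p.1.1.1.1.2), by
    refine ⟨?_, ?_⟩
    · change (insert p.1.1.2 p.1.1.1.1.2).encard = _
      rw [Set.encard_insert_of_notMem (show p.1.1.2 ∉ p.1.1.1.1.2 from p.2),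
        show p.1.1.1.1.2.encard = n from p.1.1.1.2.1]
      rfl
    · rintro y (rfl | hy)
      · exact p.1.2.symm
      · exact p.1.1.1.2.2 y hy⟩, p.1.1.2), p.1.2⟩, Set.mem_insert _ _⟩
  map_smul' g p := by
    refine Subtype.ext (Subtype.ext (Prod.ext (Subtype.ext (Prod.ext rfl ?_)) rfl))
    exact (Set.image_insert_eq (f := (g • ·))).symm

theorem insertMap_bijective (n : ℕ) : Function.Bijective (insertMap hG hIND f n) := by
  constructor
  · intro p p' h
    have h1 : p.1.1.2 = p'.1.1.2 := congrArg (fun p => p.1.1.2) h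
    have h2 : p.1.1.1.1.1 = p'.1.1.1.1.1 := congrArg (fun p => p.1.1.1.1.1) h
    have h3 : insert p.1.1.2 p.1.1.1.1.2 = insert p'.1.1.2 p'.1.1.1.1.2 :=
      congrArg (fun p => p.1.1.1.1.2) h
    have h4 : p.1.1.1.1.2 = p'.1.1.1.1.2 := by
      rw [← Set.insert_sdiff_self_of_notMem (show p.1.1.2 ∉ p.1.1.1.1.2 from p.2), h3, h1,
        Set.insert_sdiff_self_of_notMem (show p'.1.1.2 ∉ p'.1.1.1.1.2 from p'.2)]
    exact Subtype.ext (Subtype.ext (Prod.ext (Subtype.ext (Prod.ext h2 h4)) h1))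
  · rintro ⟨⟨⟨⟨⟨x, S⟩, hS, h⟩, y⟩, hxy⟩, hy⟩
    refine ⟨⟨⟨(⟨(x, S \ {y}), encard_sdiff_singleton_of_encard_eq hS hy, fun z hz => h z hz.1⟩, y),
      hxy⟩, fun hh => hh.2 rfl⟩, ?_⟩
    exact Subtype.ext (Subtype.ext (Prod.ext (Subtype.ext (Prod.ext rfl
      (Set.insert_sdiff_self_of_mem hy))) rfl))

/-- Split the pairs (S, y), with S of size n, according to whether y ∈ S. The first kind are the
flags of size n; the second are, through S ∪ {y}, the flags of size n + 1. -/
theorem Measure.val_subsets_succ (n : ℕ) :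
    (n + 1) * μ.val hX (subsetsProj hG hIND f (n + 1)) =
      μ.val hX (subsetsProj hG hIND f n) * (μ.val hX f - n) := by
  have h1 := μ.val_flag hG hIND f hX (n + 1)
  have h2 := μ.val_flag hG hIND f hX n
  have h3 := μ.val_fib hG (subsetsProj hG hIND f n) hX f
  have h4 := μ.add hX (f.comp (fibSnd hG (subsetsProj hG hIND f n) f)) _ _
    (IsDisjointUnion.of_compl (GSet.incl_injective _ (flagSub hG hIND f n))
      (S := complSub (flagSub hG hIND f n)) fun y => by
        change y ∉ flagSub hG hIND f n ↔ y ∉ Set.range Subtype.val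
        rw [Subtype.range_val]
        rfl)
  rw [μ.congr hX _ _ (insertMap_bijective hG hIND f n)] at h1
  have h5 : f.comp ((fibSnd hG (subsetsProj hG hIND f n) f).comp
      (GSet.incl _ (complSub (flagSub hG hIND f n)))) =
      (f.comp ((fibSnd hG (subsetsProj hG hIND f (n + 1)) f).comp
      (GSet.incl _ (flagSub hG hIND f (n + 1))))).comp (insertMap hG hIND f n) := rfl
  have h6 := h3.symm.trans h4
  rw [← h5] at h1
  push_cast at h1
  rw [← h1]
  linear_combination -h6 - h2

theorem Measure.val_subsets_one :
    μ.val hX (subsetsProj hG hIND f 1) = μ.val hX f := by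
  have := μ.val_subsets_succ hG hIND f hX 0
  rw [μ.val_subsets_zero, Nat.cast_zero, zero_add, one_mul, one_mul, sub_zero] at this
  exact this

theorem Measure.two_mul_val_subsets_two :
    2 * μ.val hX (subsetsProj hG hIND f 2) = μ.val hX f * (μ.val hX f - 1) := by
  have := μ.val_subsets_succ hG hIND f hX 1
  rw [μ.val_subsets_one] at this
  rw [Nat.cast_one] at this
  rw [← this]
  norm_num

end Subsets

end Oligo

/-! ### Counting orbits modulo 2 -/

namespace Oligo

open MulAction

section

variable {G : Type u} [Group G] {E : Set (Subgroup G)}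

theorem card_orbits_of_bijective {A B : Type*} [MulAction G A] [MulAction G B] {i : A →[G] B}
    (hi : Function.Bijective i) :
    Nat.card (orbitRel.Quotient G A) = Nat.card (orbitRel.Quotient G B) :=
  Nat.card_congr (Equiv.ofBijective _ (orbitMap_bijective hi))

theorem card_orbits_of_isTransitive {X : GSet E} (hX : X.IsTransitive) :
    Nat.card (orbitRel.Quotient G X) = 1 := by
  have := hX.1
  have := (pretransitive_iff_subsingleton_quotient G X).1 hX.2
  rw [Nat.card_eq_one_iff_unique]
  exact ⟨this, ⟨orbitClass hX.1.some⟩⟩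

theorem isAdditive_card_orbits (X : GSet E) (k : Type*) [CommRing k] :
    IsAdditive (fun (Y : GSet E) (_ : Y →[G] X) => (Nat.card (orbitRel.Quotient G Y) : k)) := by
  rintro Y Y₁ Y₂ f i₁ i₂ ⟨h1, h2, h3⟩
  have hbij : Function.Bijective (Sum.elim (orbitMap i₁) (orbitMap i₂)) := by
    constructor
    · refine Function.Injective.sumElim (orbitMap_injective h1) (orbitMap_injective h2) ?_
      intro p q
      induction p using Quotient.inductionOn' with | h a => ?_
      induction q using Quotient.inductionOn' with | h b => ?_
      intro h
      obtain ⟨g, hg⟩ := orbitClass_eq_iff.1 (show orbitClass (i₁ a) = orbitClass (i₂ b) from h)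
      exact Set.disjoint_left.1 h3.disjoint ⟨a, rfl⟩ ⟨g • b, by rw [map_smul, hg]⟩
    · intro q
      induction q using Quotient.inductionOn' with | h y => ?_
      have : y ∈ Set.range i₁ ⊔ Set.range i₂ := by
        rw [h3.sup_eq_top]
        trivial
      rcases this with ⟨a, rfl⟩ | ⟨b, rfl⟩
      · exact ⟨Sum.inl (orbitClass a), rfl⟩
      · exact ⟨Sum.inr (orbitClass b), rfl⟩
  change (Nat.card (orbitRel.Quotient G Y) : k) = Nat.card (orbitRel.Quotient G Y₁) +
    Nat.card (orbitRel.Quotient G Y₂)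
  rw [← Nat.card_congr (Equiv.ofBijective _ hbij), Nat.card_sum, Nat.cast_add]

theorem IsAdditive.add_three {X : GSet E} {k : Type*} [AddCommGroup k]
    {v : ∀ Y : GSet E, (Y →[G] X) → k} (hv : IsAdditive v) {Y Y₁ Y₂ Y₃ : GSet E} (f : Y →[G] X)
    {i₁ : Y₁ →[G] Y} {i₂ : Y₂ →[G] Y} {i₃ : Y₃ →[G] Y} (h1 : Function.Injective i₁)
    (h2 : Function.Injective i₂) (h3 : Function.Injective i₃) (h12 : ∀ a b, i₁ a ≠ i₂ b)
    (h13 : ∀ a b, i₁ a ≠ i₃ b) (h23 : ∀ a b, i₂ a ≠ i₃ b)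
    (h : ∀ y, y ∈ Set.range i₁ ∨ y ∈ Set.range i₂ ∨ y ∈ Set.range i₃) :
    v Y f = v Y₁ (f.comp i₁) + (v Y₂ (f.comp i₂) + v Y₃ (f.comp i₃)) := by
  rw [hv Y Y₁ (Y.sub (complSub (rangeSub i₁))) f i₁ (Y.incl _)
    (IsDisjointUnion.of_compl h1 fun y => Iff.rfl)]
  congr 1
  refine hv (Y.sub (complSub (rangeSub i₁))) Y₂ Y₃ (f.comp (Y.incl _))
    (GSet.corestrict i₂ _ fun b => ?_) (GSet.corestrict i₃ _ fun b => ?_) ⟨?_, ?_, ?_, ?_⟩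
  · rintro ⟨a, ha⟩
    exact h12 a b ha
  · rintro ⟨a, ha⟩
    exact h13 a b ha
  · intro a b hab
    exact h2 (congrArg (fun x => x.1) hab)
  · intro a b hab
    exact h3 (congrArg (fun x => x.1) hab)
  · rw [Set.disjoint_left]
    rintro _ ⟨a, rfl⟩ ⟨b, hb⟩
    exact h23 a b (congrArg (fun x => x.1) hb).symm
  · rw [codisjoint_iff, eq_top_iff]
    rintro ⟨y, hy⟩ -
    rcases h y with h | ⟨a, ha⟩ | ⟨a, ha⟩
    · exact (hy h).elim
    · exact Or.inl ⟨a, Subtype.ext ha⟩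
    · exact Or.inr ⟨a, Subtype.ext ha⟩

end

variable {G Ω : Type u} [Group G] [MulAction G Ω]

/-- The measure valued in a ring of characteristic two that counts orbits. -/
noncomputable def parityMeasure (hodd : IsOdd G Ω) (k : Type*) [CommRing k] (hk : (2 : k) = 0) :
    Measure (stabClass G Ω) k where
  val {Y _} _ _ := (Nat.card (orbitRel.Quotient G Y) : k)
  iso {Y X} hX f hf := by
    rw [card_orbits_of_bijective hf, card_orbits_of_isTransitive hX, Nat.cast_one]
  add {Y Y₁ Y₂ X} hX f i₁ i₂ h := isAdditive_card_orbits X k Y Y₁ Y₂ f i₁ i₂ h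
  comp hZ hY hX f g := by
    rw [card_orbits_of_isTransitive hZ, card_orbits_of_isTransitive hY, Nat.cast_one, mul_one]
  baseChange {X Y X' Y'} hX hX' f g f' g' h := by
    classical
    have := Fintype.ofFinite (orbitRel.Quotient G Y)
    -- The part of Y' over one orbit of Y is a fiber product of transitive sets, so it has an odd
    -- number of orbits. Hence Y' and Y have equally many orbits modulo 2.
    rw [(isAdditive_card_orbits X' k).sum_preimage f' g']
    have key : ∀ q : orbitRel.Quotient G Y, (Nat.card (orbitRel.Quotient G
        (Y'.sub (preimageSub g' (orbitSub q)))) : k) = 1 := by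
      intro q
      let i : Y'.sub (preimageSub g' (orbitSub q)) →[G]
          fiberProduct (f.comp (Y.incl (orbitSub q))) g :=
        { toFun := fun y => ⟨(⟨g' y.1, y.2⟩, f' y.1), by
            have : (g' y.1, f' y.1) ∈ (fiberProduct f g : Set (Y × X')) := by
              rw [← h.2]
              exact ⟨y.1, rfl⟩
            exact this⟩
          map_smul' := fun c y => Subtype.ext (Prod.ext (Subtype.ext (map_smul g' c y.1))
            (map_smul f' c y.1)) }
      have hi : Function.Bijective i := by
        constructor
        · intro a b hab
          have h1 : g' a.1 = g' b.1 := congrArg (fun p => p.1.1.1) hab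
          have h2 : f' a.1 = f' b.1 := congrArg (fun p => p.1.2) hab
          exact Subtype.ext (h.1 (Prod.ext h1 h2))
        · rintro ⟨⟨⟨y, hy⟩, x⟩, hp⟩
          have : (y, x) ∈ (fiberProduct f g : Set (Y × X')) := hp
          rw [← h.2] at this
          obtain ⟨y', hy'⟩ := this
          have h1 : g' y' = y := congrArg Prod.fst hy'
          have h2 : f' y' = x := congrArg Prod.snd hy'
          refine ⟨⟨y', ?_⟩, ?_⟩
          · change g' y' ∈ orbitSub q
            rw [h1]
            exact hy
          · exact Subtype.ext (Prod.ext (Subtype.ext h1) h2)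
      rw [card_orbits_of_bijective hi]
      obtain ⟨m, hm⟩ := hodd hX (Y.orb_isTransitive q) hX' (f.comp (Y.incl (orbitSub q))) g
      rw [hm]
      push_cast
      rw [hk]
      ring
    rw [Finset.sum_congr rfl fun q _ => key q, Finset.sum_const, Finset.card_univ,
      Nat.card_eq_fintype_card, nsmul_eq_mul, mul_one]

/-! ### Pairs in fibers: disjoint unions and base change -/

section SubsetsTwo

variable (hG : IsOligomorphic G Ω) (hIND : IND G Ω 1)
  {k : Type*} [CommRing k] (μ : Measure (stabClass G Ω) k)

theorem Measure.val_subsets_two_of_injective {X Y : GSet (stabClass G Ω)} (hX : X.IsTransitive)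
    (f : Y →[G] X) (hf : Function.Injective f) : μ.val hX (subsetsProj hG hIND f 2) = 0 := by
  have : IsEmpty (GSet.subsets hG hIND f 2) := by
    constructor
    rintro ⟨⟨x, S⟩, hS, h⟩
    obtain ⟨a, b, hab, rfl⟩ := Set.encard_eq_two.1 hS
    exact hab (hf ((h a (by simp)).trans (h b (by simp)).symm))
  exact (μ.isAdditive hX).eq_zero _

/-- The map on `n`-element subsets of fibers induced by an injective map. -/
def subsetsMap {X Y Y₁ : GSet (stabClass G Ω)} (f : Y →[G] X) (i : Y₁ →[G] Y)
    (hi : Function.Injective i) (n : ℕ) :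
    GSet.subsets hG hIND (f.comp i) n →[G] GSet.subsets hG hIND f n where
  toFun p := ⟨(p.1.1, i '' p.1.2), (hi.encard_image _).trans p.2.1, by
    rintro _ ⟨y, hy, rfl⟩
    exact p.2.2 y hy⟩
  map_smul' g p := Subtype.ext (Prod.ext rfl (Set.image_smul_comm i g p.1.2 (map_smul i g)))

theorem subsetsMap_injective {X Y Y₁ : GSet (stabClass G Ω)} (f : Y →[G] X) (i : Y₁ →[G] Y)
    (hi : Function.Injective i) (n : ℕ) :
    Function.Injective (subsetsMap hG hIND f i hi n) := by
  intro a b h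
  have h1 : a.1.1 = b.1.1 := congrArg (fun p => p.1.1) h
  have h2 : i '' a.1.2 = i '' b.1.2 := congrArg (fun p => p.1.2) h
  exact Subtype.ext (Prod.ext h1 (hi.image_injective h2))

/-- A pair lies in one of the two parts or has one point in each; the mixed pairs form the fiber
product of the parts. -/
theorem Measure.val_subsets_two_add {X Y Y₁ Y₂ : GSet (stabClass G Ω)} (hX : X.IsTransitive)
    (f : Y →[G] X) (i₁ : Y₁ →[G] Y) (i₂ : Y₂ →[G] Y) (h : IsDisjointUnion i₁ i₂) :
    μ.val hX (subsetsProj hG hIND f 2) = μ.val hX (subsetsProj hG hIND (f.comp i₁) 2) +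
      (μ.val hX (subsetsProj hG hIND (f.comp i₂) 2) +
        μ.val hX (f.comp i₁) * μ.val hX (f.comp i₂)) := by
  obtain ⟨h1, h2, h3⟩ := h
  have hne : ∀ a b, i₁ a ≠ i₂ b := fun a b hab =>
    Set.disjoint_left.1 h3.disjoint ⟨a, rfl⟩ ⟨b, hab.symm⟩
  have hcov : ∀ y, y ∈ Set.range i₁ ∨ y ∈ Set.range i₂ := by
    intro y
    have : y ∈ Set.range i₁ ⊔ Set.range i₂ := by
      rw [h3.sup_eq_top]
      trivial
    exact this
  let j₃ : GSet.fib hG (f.comp i₁) (f.comp i₂) →[G] GSet.subsets hG hIND f 2 :=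
    { toFun := fun p => ⟨(f (i₂ p.1.2), {i₁ p.1.1, i₂ p.1.2}), Set.encard_pair (hne _ _), by
        rintro y (rfl | rfl)
        · exact p.2
        · rfl⟩
      map_smul' := fun g p => by
        refine Subtype.ext (Prod.ext ?_ ?_)
        · change f (i₂ (g • p.1.2)) = g • f (i₂ p.1.2)
          rw [map_smul, map_smul]
        · change {i₁ (g • p.1.1), i₂ (g • p.1.2)} = g • ({i₁ p.1.1, i₂ p.1.2} : Set Y)
          rw [map_smul, map_smul, ← Set.image_smul, Set.image_pair] }
  have hmem : ∀ p, i₁ p.1.1 ∈ (j₃ p).1.2 ∧ i₂ p.1.2 ∈ (j₃ p).1.2 := fun p =>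
    ⟨Or.inl rfl, Or.inr rfl⟩
  rw [(μ.isAdditive hX).add_three (subsetsProj hG hIND f 2)
    (subsetsMap_injective hG hIND f i₁ h1 2) (subsetsMap_injective hG hIND f i₂ h2 2) (i₃ := j₃)]
  · rw [← μ.val_fib hG (f.comp i₁) hX (f.comp i₂)]
    rfl
  · intro a b hab
    have hS : ({i₁ a.1.1, i₂ a.1.2} : Set Y) = {i₁ b.1.1, i₂ b.1.2} :=
      congrArg (fun p => p.1.2) hab
    have ha1 : i₁ a.1.1 ∈ ({i₁ b.1.1, i₂ b.1.2} : Set Y) := hS ▸ Or.inl rfl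
    have ha2 : i₂ a.1.2 ∈ ({i₁ b.1.1, i₂ b.1.2} : Set Y) := hS ▸ Or.inr rfl
    refine Subtype.ext (Prod.ext (h1 ?_) (h2 ?_))
    · exact ha1.resolve_right (hne _ _)
    · exact ha2.resolve_left (hne _ _).symm
  · intro a b hab
    have hS : i₁ '' a.1.2 = i₂ '' b.1.2 := congrArg (fun p => p.1.2) hab
    obtain ⟨y, _, hy, _⟩ := Set.encard_eq_two.1 a.2.1
    have : i₁ y ∈ i₂ '' b.1.2 := hS ▸ ⟨y, by simp_all, rfl⟩
    obtain ⟨z, _, hz⟩ := this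
    exact hne _ _ hz.symm
  · intro a b hab
    have hS : i₁ '' a.1.2 = (j₃ b).1.2 := congrArg (fun p => p.1.2) hab
    obtain ⟨y, _, hy⟩ := hS ▸ (hmem b).2
    exact hne _ _ hy
  · intro a b hab
    have hS : i₂ '' a.1.2 = (j₃ b).1.2 := congrArg (fun p => p.1.2) hab
    obtain ⟨y, _, hy⟩ := hS ▸ (hmem b).1
    exact hne _ _ hy.symm
  · rintro ⟨⟨x, S⟩, hS, hx⟩
    obtain ⟨a, b, hab, rfl⟩ := Set.encard_eq_two.1 hS
    have hxa := hx a (Or.inl rfl)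
    have hxb := hx b (Or.inr rfl)
    rcases hcov a with ⟨a, rfl⟩ | ⟨a, rfl⟩ <;> rcases hcov b with ⟨b, rfl⟩ | ⟨b, rfl⟩
    · refine Or.inl ⟨⟨(x, {a, b}), Set.encard_pair fun h => hab (congrArg i₁ h), ?_⟩, ?_⟩
      · rintro y (rfl | rfl)
        exacts [hxa, hxb]
      · exact Subtype.ext (Prod.ext rfl (Set.image_pair _ _ _))
    · refine Or.inr (Or.inr ⟨⟨(a, b), hxa.trans hxb.symm⟩, ?_⟩)
      exact Subtype.ext (Prod.ext hxb rfl)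
    · refine Or.inr (Or.inr ⟨⟨(b, a), hxb.trans hxa.symm⟩, ?_⟩)
      exact Subtype.ext (Prod.ext hxa (Set.pair_comm _ _))
    · refine Or.inr (Or.inl ⟨⟨(x, {a, b}), Set.encard_pair fun h => hab (congrArg i₂ h), ?_⟩, ?_⟩)
      · rintro y (rfl | rfl)
        exacts [hxa, hxb]
      · exact Subtype.ext (Prod.ext rfl (Set.image_pair _ _ _))

theorem Measure.val_subsets_baseChange {X Y X' Y' : GSet (stabClass G Ω)} (hX : X.IsTransitive)
    (hX' : X'.IsTransitive) (f : Y →[G] X) (g : X' →[G] X) (f' : Y' →[G] X') (g' : Y' →[G] Y)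
    (h : IsBaseChange f g f' g') (n : ℕ) :
    μ.val hX (subsetsProj hG hIND f n) = μ.val hX' (subsetsProj hG hIND f' n) := by
  have hcomm : ∀ y, f (g' y) = g (f' y) := fun y => by
    have : (g' y, f' y) ∈ (fiberProduct f g : Set (Y × X')) := by
      rw [← h.2]
      exact ⟨y, rfl⟩
    exact this
  have hinj : ∀ p : GSet.subsets hG hIND f' n, Set.InjOn g' p.1.2 := fun p a ha b hb hab =>
    h.1 (Prod.ext hab ((p.2.2 a ha).trans (p.2.2 b hb).symm))
  let j : GSet.subsets hG hIND f' n →[G] GSet.subsets hG hIND f n :=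
    { toFun := fun p => ⟨(g p.1.1, g' '' p.1.2), (hinj p).encard_image.trans p.2.1, by
        rintro _ ⟨y, hy, rfl⟩
        rw [hcomm, p.2.2 y hy]⟩
      map_smul' := fun c p => Subtype.ext (Prod.ext (map_smul g c p.1.1)
        (Set.image_smul_comm g' c p.1.2 (map_smul g' c))) }
  refine μ.baseChange hX hX' _ g _ j ⟨?_, ?_⟩
  · intro a b hab
    have h1 : a.1.1 = b.1.1 := congrArg (fun p => p.2) hab
    have h2 : g' '' a.1.2 = g' '' b.1.2 := congrArg (fun p => p.1.1.2) hab
    have key : ∀ a b : GSet.subsets hG hIND f' n, a.1.1 = b.1.1 → g' '' a.1.2 = g' '' b.1.2 →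
        a.1.2 ⊆ b.1.2 := by
      intro a b h1 h2 y hy
      obtain ⟨z, hz, hzy⟩ := h2 ▸ Set.mem_image_of_mem g' hy
      have : z = y := h.1 (Prod.ext hzy ((b.2.2 z hz).trans (h1.symm.trans (a.2.2 y hy).symm)))
      exact this ▸ hz
    exact Subtype.ext (Prod.ext h1 ((key a b h1 h2).antisymm (key b a h1.symm h2.symm)))
  · ext ⟨⟨⟨x, S⟩, hS, hx⟩, x'⟩
    constructor
    · rintro ⟨a, ha⟩
      have h1 : g a.1.1 = x := congrArg (fun p => p.1.1.1) ha
      have h2 : a.1.1 = x' := congrArg (fun p => p.2) ha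
      change x = g x'
      rw [← h1, h2]
    · intro hxx
      have hxx : x = g x' := hxx
      have hex : ∀ y ∈ S, ∃ y', g' y' = y ∧ f' y' = x' := by
        intro y hy
        have : (y, x') ∈ (fiberProduct f g : Set (Y × X')) := (hx y hy).trans hxx
        rw [← h.2] at this
        obtain ⟨y', hy'⟩ := this
        exact ⟨y', congrArg Prod.fst hy', congrArg Prod.snd hy'⟩
      have himg : g' '' {y' | f' y' = x' ∧ g' y' ∈ S} = S := by
        ext y
        constructor
        · rintro ⟨y', hy', rfl⟩
          exact hy'.2
        · intro hy
          obtain ⟨y', h1, h2⟩ := hex y hy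
          exact ⟨y', ⟨h2, h1 ▸ hy⟩, h1⟩
      refine ⟨⟨(x', {y' | f' y' = x' ∧ g' y' ∈ S}), ?_, fun y hy => hy.1⟩, ?_⟩
      · rw [← hS]
        change _ = S.encard
        conv_rhs => rw [← himg]
        refine (Set.InjOn.encard_image ?_).symm
        intro a ha b hb hab
        exact h.1 (Prod.ext hab (ha.1.trans hb.1.symm))
      · exact Prod.ext (Subtype.ext (Prod.ext hxx.symm himg)) rfl

end SubsetsTwo

end Oligo

namespace Oligo

open MulAction

variable {G Ω : Type u} [Group G] [MulAction G Ω]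

theorem eq_pair_of_encard_eq_two {α : Type*} {S : Set α} (hS : S.encard = (2 : ℕ)) {a b : α}
    (ha : a ∈ S) (hb : b ∈ S) (hab : a ≠ b) : S = {a, b} := by
  refine ((Set.toFinite {a, b}).eq_of_subset_of_encard_le ?_ ?_).symm
  · rintro z (rfl | rfl)
    exacts [ha, hb]
  · rw [hS, Set.encard_pair hab]
    rfl

/-! ### Pairs in fibers: composition -/

section SubsetsTwoComp

variable (hG : IsOligomorphic G Ω) (hIND : IND G Ω 1)
  {k : Type*} [CommRing k] (μ : Measure (stabClass G Ω) k)

/-- A pair of points in a fiber of `g : Z → Y`, as a pair in a fiber of `Z → Y → X`. -/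
def verticalPairs {X Y Z : GSet (stabClass G Ω)} (f : Y →[G] X) (g : Z →[G] Y) :
    GSet.subsets hG hIND g 2 →[G] GSet.subsets hG hIND (f.comp g) 2 where
  toFun p := ⟨(f p.1.1, p.1.2), p.2.1, fun z hz => congrArg f (p.2.2 z hz)⟩
  map_smul' c p := Subtype.ext (Prod.ext (map_smul f c p.1.1) rfl)

theorem mem_range_verticalPairs {X Y Z : GSet (stabClass G Ω)} {f : Y →[G] X} {g : Z →[G] Y}
    {p : GSet.subsets hG hIND (f.comp g) 2} {a b : Z} (ha : a ∈ p.1.2) (hb : b ∈ p.1.2)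
    (hab : a ≠ b) : p ∈ Set.range (verticalPairs hG hIND f g) ↔ g a = g b := by
  have hS : p.1.2 = {a, b} := eq_pair_of_encard_eq_two p.2.1 ha hb hab
  constructor
  · rintro ⟨q, rfl⟩
    exact (q.2.2 a ha).trans (q.2.2 b hb).symm
  · intro h
    refine ⟨⟨(g a, p.1.2), p.2.1, ?_⟩, Subtype.ext (Prod.ext (p.2.2 a ha) rfl)⟩
    intro z hz
    have hz : z ∈ p.1.2 := hz
    rw [hS] at hz
    rcases hz with rfl | rfl
    exacts [rfl, h.symm]

/-- The pairs of points in a fiber of `Z → Y → X` with distinct images in `Y`. -/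
def transversePairs {X Y Z : GSet (stabClass G Ω)} (f : Y →[G] X) (g : Z →[G] Y) :
    SubMulAction G (GSet.subsets hG hIND (f.comp g) 2) :=
  complSub (rangeSub (verticalPairs hG hIND f g))

/-- The image of a transverse pair. -/
def transverseImage {X Y Z : GSet (stabClass G Ω)} (f : Y →[G] X) (g : Z →[G] Y) :
    (GSet.subsets hG hIND (f.comp g) 2).sub (transversePairs hG hIND f g) →[G]
      GSet.subsets hG hIND f 2 where
  toFun p := ⟨(p.1.1.1, g '' p.1.1.2), by
    refine ⟨?_, ?_⟩
    · rw [← show p.1.1.2.encard = ((2 : ℕ) : ℕ∞) from p.1.2.1]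
      apply Set.InjOn.encard_image
      intro a ha b hb hab
      by_contra hne
      exact p.2 ((mem_range_verticalPairs hG hIND ha hb hne).2 hab)
    · rintro _ ⟨z, hz, rfl⟩
      exact p.1.2.2 z hz⟩
  map_smul' c p := Subtype.ext (Prod.ext rfl (Set.image_smul_comm g c p.1.1.2 (map_smul g c)))

/-- A pair in Y is fixed pointwise by its stabilizer, so its points can be ordered equivariantly
along the orbit T of the pair. A transverse pair above it is then an independent choice of a point
of Z over each: the fiber product over T of two base changes of g. -/
theorem Measure.val_overOrbit_transverseImage {X Y Z : GSet (stabClass G Ω)}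
    (hY : Y.IsTransitive) (f : Y →[G] X) (g : Z →[G] Y)
    (q : orbitRel.Quotient G (GSet.subsets hG hIND f 2)) :
    μ.val (GSet.orb_isTransitive _ q) (overOrbit (transverseImage hG hIND f g) q) =
      μ.val hY g * μ.val hY g := by
  have hT := GSet.orb_isTransitive (GSet.subsets hG hIND f 2) q
  have := hT.2
  obtain ⟨t⟩ := hT.1
  obtain ⟨y₁, y₂, hne, hS⟩ := Set.encard_eq_two.1 t.1.2.1
  have hstab : ∀ y ∈ t.1.1.2, stabilizer G t ≤ stabilizer G y := by
    intro y hy c hc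
    have hc : c ∈ stabilizer G t.1 := by
      have hc : c • t = t := hc
      exact congrArg Subtype.val hc
    exact mem_fixing_of_mem_stabilizer hG hIND hc hy
  obtain ⟨p₁, hp₁⟩ := exists_smul_eq_of_stabilizer_le (hstab y₁ (hS ▸ Or.inl rfl))
  obtain ⟨p₂, hp₂⟩ := exists_smul_eq_of_stabilizer_le (hstab y₂ (hS ▸ Or.inr rfl))
  have hset : ∀ s : (GSet.subsets hG hIND f 2).orb q, s.1.1.2 = {p₁ s, p₂ s} ∧ p₁ s ≠ p₂ s := by
    intro s
    obtain ⟨c, rfl⟩ := exists_smul_eq G t s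
    rw [map_smul, map_smul, hp₁, hp₂]
    refine ⟨?_, fun h => hne (smul_left_cancel c h)⟩
    change c • t.1.1.2 = _
    rw [hS, ← Set.image_smul, Set.image_pair]
  -- For `w : F`, the two points of Z are `w.1.1.1.1` and `w.1.2.1.1`; the base pair is `w.1.2.1.2`.
  let F := GSet.fib hG (fibSnd hG g p₁) (fibSnd hG g p₂)
  have hFg : ∀ w : F, g w.1.1.1.1 = p₁ w.1.2.1.2 ∧ g w.1.2.1.1 = p₂ w.1.2.1.2 := by
    intro w
    have hw : w.1.1.1.2 = w.1.2.1.2 := w.2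
    exact ⟨w.1.1.2.trans (congrArg p₁ hw), w.1.2.2⟩
  have hFne : ∀ w : F, w.1.1.1.1 ≠ w.1.2.1.1 := by
    intro w h
    apply (hset w.1.2.1.2).2
    rw [← (hFg w).1, ← (hFg w).2, h]
  have hfib : ∀ w : F, ∀ z ∈ ({w.1.1.1.1, w.1.2.1.1} : Set Z),
      f (g z) = w.1.2.1.2.1.1.1 := by
    rintro w z (rfl | rfl)
    · rw [(hFg w).1]
      exact w.1.2.1.2.1.2.2 _ ((hset w.1.2.1.2).1 ▸ Or.inl rfl)
    · rw [(hFg w).2]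
      exact w.1.2.1.2.1.2.2 _ ((hset w.1.2.1.2).1 ▸ Or.inr rfl)
  let e₀ : F →[G] GSet.subsets hG hIND (f.comp g) 2 :=
    { toFun := fun w => ⟨(w.1.2.1.2.1.1.1, {w.1.1.1.1, w.1.2.1.1}), Set.encard_pair (hFne w),
        hfib w⟩
      map_smul' := fun c w => Subtype.ext (Prod.ext rfl (by
        change {c • w.1.1.1.1, c • w.1.2.1.1} = c • ({w.1.1.1.1, w.1.2.1.1} : Set Z)
        rw [← Set.image_smul, Set.image_pair])) }
  let e₁ := GSet.corestrict e₀ (transversePairs hG hIND f g) (fun w hw => by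
    have hw' := (mem_range_verticalPairs hG hIND (p := e₀ w) (Or.inl rfl) (Or.inr rfl) (hFne w)).1 hw
    apply (hset w.1.2.1.2).2
    rw [← (hFg w).1, ← (hFg w).2, hw'])
  have himg : ∀ w, transverseImage hG hIND f g (e₁ w) = w.1.2.1.2.1 := by
    intro w
    refine Subtype.ext (Prod.ext rfl ?_)
    change g '' {w.1.1.1.1, w.1.2.1.1} = _
    rw [Set.image_pair, (hFg w).1, (hFg w).2, ← (hset w.1.2.1.2).1]
  let e := GSet.corestrict e₁ (preimageSub (transverseImage hG hIND f g) (orbitSub q)) (fun w => by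
    change transverseImage hG hIND f g (e₁ w) ∈ orbitSub q
    rw [himg]
    exact w.1.2.1.2.2)
  have he : Function.Bijective e := by
    constructor
    · intro w w' h
      have h1 : e₁ w = e₁ w' := congrArg (fun p => p.1) h
      have h2 : ({w.1.1.1.1, w.1.2.1.1} : Set Z) = {w'.1.1.1.1, w'.1.2.1.1} :=
        congrArg (fun p => p.1.1.2) h1
      have h3 : w.1.2.1.2 = w'.1.2.1.2 := by
        apply Subtype.ext
        rw [← himg, ← himg, h1]
      have hw : w.1.1.1.2 = w.1.2.1.2 := w.2
      have hw' : w'.1.1.1.2 = w'.1.2.1.2 := w'.2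
      have ha : w.1.1.1.1 ∈ ({w'.1.1.1.1, w'.1.2.1.1} : Set Z) := h2 ▸ Or.inl rfl
      have hb : w.1.2.1.1 ∈ ({w'.1.1.1.1, w'.1.2.1.1} : Set Z) := h2 ▸ Or.inr rfl
      have ha' : w.1.1.1.1 = w'.1.1.1.1 := by
        rcases ha with ha | ha
        · exact ha
        · exfalso
          apply (hset w.1.2.1.2).2
          have := (hFg w).1
          rw [ha, (hFg w').2, ← h3] at this
          exact this.symm
      have hb' : w.1.2.1.1 = w'.1.2.1.1 := by
        rcases hb with hb | hb
        · exfalso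
          apply (hset w.1.2.1.2).2
          have := (hFg w).2
          rw [hb, (hFg w').1, ← h3] at this
          exact this
        · exact hb
      refine Subtype.ext (Prod.ext (Subtype.ext (Prod.ext ha' ?_)) (Subtype.ext (Prod.ext hb' h3)))
      rw [hw, hw', h3]
    · rintro ⟨d, hd⟩
      let s : (GSet.subsets hG hIND f 2).orb q := ⟨transverseImage hG hIND f g d, hd⟩
      have hs : g '' d.1.1.2 = {p₁ s, p₂ s} := (hset s).1
      obtain ⟨a, ha, hga⟩ : p₁ s ∈ g '' d.1.1.2 := hs ▸ Or.inl rfl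
      obtain ⟨b, hb, hgb⟩ : p₂ s ∈ g '' d.1.1.2 := hs ▸ Or.inr rfl
      have hab : a ≠ b := by
        rintro rfl
        exact (hset s).2 (hga.symm.trans hgb)
      have hd2 : {a, b} = d.1.1.2 := (eq_pair_of_encard_eq_two d.1.2.1 ha hb hab).symm
      refine ⟨⟨(⟨(a, s), hga⟩, ⟨(b, s), hgb⟩), rfl⟩, ?_⟩
      exact Subtype.ext (Subtype.ext (Subtype.ext (Prod.ext rfl hd2)))
  have hcomm : (overOrbit (transverseImage hG hIND f g) q).comp e =
      (fibSnd hG g p₂).comp (fibSnd hG (fibSnd hG g p₁) (fibSnd hG g p₂)) := by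
    ext w
    exact Subtype.ext (himg w)
  rw [μ.congr _ _ e he, hcomm, μ.val_fib hG (fibSnd hG g p₁) hT (fibSnd hG g p₂),
    ← μ.baseChange hY hT g p₁ _ _ (isBaseChange_fib hG g p₁),
    ← μ.baseChange hY hT g p₂ _ _ (isBaseChange_fib hG g p₂)]

/-- The first term counts pairs inside a fiber of g, the second those whose points have distinct
images in Y. -/
theorem Measure.val_subsets_two_comp {X Y Z : GSet (stabClass G Ω)} (hY : Y.IsTransitive)
    (hX : X.IsTransitive) (f : Y →[G] X) (g : Z →[G] Y) :
    μ.val hX (subsetsProj hG hIND (f.comp g) 2) =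
      μ.val hX f * μ.val hY (subsetsProj hG hIND g 2) +
        μ.val hY g ^ 2 * μ.val hX (subsetsProj hG hIND f 2) := by
  have hinj : Function.Injective (verticalPairs hG hIND f g) := by
    intro a b hab
    have h2 : a.1.2 = b.1.2 := congrArg (fun p => p.1.2) hab
    obtain ⟨z, _, _, hz⟩ := Set.encard_eq_two.1 a.2.1
    have hza : z ∈ a.1.2 := hz ▸ Or.inl rfl
    have h1 : a.1.1 = b.1.1 := (a.2.2 z hza).symm.trans (b.2.2 z (h2 ▸ hza))
    exact Subtype.ext (Prod.ext h1 h2)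
  rw [μ.add hX (subsetsProj hG hIND (f.comp g) 2) _ _ (IsDisjointUnion.of_compl hinj
    (S := transversePairs hG hIND f g) fun y => Iff.rfl)]
  congr 1
  · rw [← μ.comp_val]
    rfl
  · rw [sq]
    exact μ.val_comp_of_const hX (subsetsProj hG hIND f 2) (transverseImage hG hIND f g) _
      fun q => μ.val_overOrbit_transverseImage hG hIND hY f g q

end SubsetsTwoComp

/-! ### Lifting a measure from ℤ/n to ℤ/2n -/

section Lift

variable {n : ℕ}

/-- The operation `x² - 2b`, which depends on `x` modulo `n` and `b` modulo `n` only up to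
multiples of `2n` if `n` is even. -/
def adamsTwo (x b : ZMod n) : ZMod (2 * n) := ((x.cast : ℤ) ^ 2 - 2 * (b.cast : ℤ) : ℤ)

/-- Replacing x by x + nc changes x² by 2ncx + n²c², and 2n divides n² because n is even. -/
theorem adamsTwo_intCast (hn : 2 ∣ n) (x b : ℤ) :
    adamsTwo (x : ZMod n) (b : ZMod n) = (x ^ 2 - 2 * b : ℤ) := by
  obtain ⟨c, hc⟩ : (n : ℤ) ∣ ((x : ZMod n).cast : ℤ) - x := by
    rw [← ZMod.intCast_eq_intCast_iff_dvd_sub, ZMod.intCast_zmod_cast]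
  obtain ⟨d, hd⟩ : (n : ℤ) ∣ ((b : ZMod n).cast : ℤ) - b := by
    rw [← ZMod.intCast_eq_intCast_iff_dvd_sub, ZMod.intCast_zmod_cast]
  obtain ⟨m, rfl⟩ := hn
  rw [adamsTwo, eq_comm, ZMod.intCast_eq_intCast_iff_dvd_sub]
  rw [sub_eq_iff_eq_add] at hc hd
  rw [hc, hd]
  refine ⟨c * x + c ^ 2 * m - d, ?_⟩
  push_cast
  ring

theorem adamsTwo_one_zero (hn : 2 ∣ n) : adamsTwo (1 : ZMod n) 0 = 1 := by
  have := adamsTwo_intCast hn 1 0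
  simpa using this

theorem adamsTwo_add (hn : 2 ∣ n) (x y b c : ZMod n) :
    adamsTwo (x + y) (b + (c + x * y)) = adamsTwo x b + adamsTwo y c := by
  obtain ⟨x, rfl⟩ := ZMod.intCast_surjective x
  obtain ⟨y, rfl⟩ := ZMod.intCast_surjective y
  obtain ⟨b, rfl⟩ := ZMod.intCast_surjective b
  obtain ⟨c, rfl⟩ := ZMod.intCast_surjective c
  norm_cast
  simp only [adamsTwo_intCast hn]
  push_cast
  ring

/-- On integer representatives the two sides differ by 2c(x² - x - 2b) up to sign, and n divides the
bracket. -/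
theorem adamsTwo_mul (hn : 2 ∣ n) (x y b c : ZMod n) (h : 2 * b = x * (x - 1)) :
    adamsTwo (x * y) (x * c + y ^ 2 * b) = adamsTwo x b * adamsTwo y c := by
  obtain ⟨x, rfl⟩ := ZMod.intCast_surjective x
  obtain ⟨y, rfl⟩ := ZMod.intCast_surjective y
  obtain ⟨b, rfl⟩ := ZMod.intCast_surjective b
  obtain ⟨c, rfl⟩ := ZMod.intCast_surjective c
  have h' : ((2 * b : ℤ) : ZMod n) = ((x * (x - 1) : ℤ) : ZMod n) := by
    push_cast
    exact h
  obtain ⟨d, hd⟩ := (ZMod.intCast_eq_intCast_iff_dvd_sub _ _ _).1 h'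
  norm_cast
  simp only [adamsTwo_intCast hn]
  rw [← Int.cast_mul, ZMod.intCast_eq_intCast_iff_dvd_sub]
  refine ⟨-c * d, ?_⟩
  push_cast
  linear_combination (-2 * c) * hd

theorem castHom_adamsTwo (x b : ZMod n) (h : 2 * b = x * (x - 1)) :
    ZMod.castHom (dvd_mul_left n 2) (ZMod n) (adamsTwo x b) = x := by
  rw [adamsTwo, map_intCast]
  rw [Int.cast_sub, Int.cast_pow, Int.cast_mul, ZMod.intCast_zmod_cast, ZMod.intCast_zmod_cast,
    Int.cast_ofNat, h]
  ring

/-- The lift of a measure from `ℤ/n` to `ℤ/2n`, for even `n`. -/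
def Measure.lift (hG : IsOligomorphic G Ω) (hIND : IND G Ω 1) (hn : 2 ∣ n)
    (μ : Measure (stabClass G Ω) (ZMod n)) : Measure (stabClass G Ω) (ZMod (2 * n)) where
  val hX f := adamsTwo (μ.val hX f) (μ.val hX (subsetsProj hG hIND f 2))
  iso hX f hf := by
    rw [μ.iso hX f hf, μ.val_subsets_two_of_injective hG hIND hX f hf.1, adamsTwo_one_zero hn]
  add hX f i₁ i₂ h := by
    rw [μ.add hX f i₁ i₂ h, μ.val_subsets_two_add hG hIND hX f i₁ i₂ h, adamsTwo_add hn]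
  comp hZ hY hX f g := by
    rw [μ.comp hZ hY hX f g, μ.val_subsets_two_comp hG hIND hY hX f g,
      adamsTwo_mul hn _ _ _ _ (μ.two_mul_val_subsets_two hG hIND f hX)]
  baseChange hX hX' f g f' g' h := by
    rw [μ.baseChange hX hX' f g f' g' h, μ.val_subsets_baseChange hG hIND hX hX' f g f' g' h]

/-- The modulus m is kept free so that powers of 2 can be used without transport along 2 * 2 ^ n = 2
^ (n + 1). -/
theorem Measure.exists_lift (hG : IsOligomorphic G Ω) (hIND : IND G Ω 1) (hn : 2 ∣ n) {m : ℕ}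
    (hm : m = 2 * n) (μ : Measure (stabClass G Ω) (ZMod n)) :
    ∃ μ' : Measure (stabClass G Ω) (ZMod m), ∀ (h : n ∣ m) {X Y : GSet (stabClass G Ω)}
      (hX : X.IsTransitive) (f : Y →[G] X),
      ZMod.castHom h (ZMod n) (μ'.val hX f) = μ.val hX f := by
  subst hm
  exact ⟨μ.lift hG hIND hn, fun _ X Y hX f =>
    castHom_adamsTwo _ _ (μ.two_mul_val_subsets_two hG hIND f hX)⟩

end Lift

end Oligo

namespace Oligo

open MulAction

/-! ### Measures as homomorphisms from the universal ring -/

section Hom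

variable {G : Type u} [Group G] {E : Set (Subgroup G)} {k : Type*} [CommRing k]

/-- The ring homomorphism from the universal ring classifying a measure. -/
noncomputable def Measure.toHom (μ : Measure E k) : Theta E →+* k :=
  Ideal.Quotient.lift (thetaIdeal E)
    (MvPolynomial.eval₂Hom (Int.castRingHom k) fun m => μ.val m.transitive m.hom) (by
      intro p hp
      rw [← RingHom.mem_ker]
      revert p
      change thetaIdeal E ≤ _
      rw [thetaIdeal, Ideal.span_le]
      rintro p hp
      rw [SetLike.mem_coe, RingHom.mem_ker]
      induction hp with
      | iso hX f hf => simp [symb, μ.iso hX f hf]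
      | add hX f i₁ i₂ h => simp [symb, μ.add hX f i₁ i₂ h]
      | comp hZ hY hX f g => simp [symb, μ.comp hZ hY hX f g]
      | baseChange hX hX' f g f' g' h => simp [symb, μ.baseChange hX hX' f g f' g' h])

theorem Measure.toHom_cls (μ : Measure E k) {X Y : GSet E} (hX : X.IsTransitive) (f : Y →[G] X) :
    μ.toHom (Theta.cls hX f) = μ.val hX f := by
  rw [Measure.toHom, Theta.cls, Ideal.Quotient.lift_mk, symb, MvPolynomial.coe_eval₂Hom,
    MvPolynomial.eval₂_X]

theorem Theta.mk_eq_mk {p q : MvPolynomial (GMap E) ℤ} (h : IsThetaRelation E (p - q)) :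
    Ideal.Quotient.mk (thetaIdeal E) p = Ideal.Quotient.mk (thetaIdeal E) q :=
  Ideal.Quotient.eq.2 (Ideal.subset_span h)

/-- The measure attached to a ring homomorphism from the universal ring. -/
noncomputable def Measure.ofHom (φ : Theta E →+* k) : Measure E k where
  val hX f := φ (Theta.cls hX f)
  iso hX f hf := by
    rw [← map_one φ]
    exact congrArg φ (Theta.mk_eq_mk (.iso hX f hf))
  add hX f i₁ i₂ h := by
    rw [← map_add φ]
    exact congrArg φ (Theta.mk_eq_mk (.add hX f i₁ i₂ h))
  comp hZ hY hX f g := by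
    rw [← map_mul φ]
    exact congrArg φ (Theta.mk_eq_mk (.comp hZ hY hX f g))
  baseChange hX hX' f g f' g' h :=
    congrArg φ (Theta.mk_eq_mk (.baseChange hX hX' f g f' g' h))

theorem Theta.hom_ext {R : Type*} [CommRing R] {φ ψ : Theta E →+* R}
    (h : ∀ {X Y : GSet E} (hX : X.IsTransitive) (f : Y →[G] X),
      φ (Theta.cls hX f) = ψ (Theta.cls hX f)) : φ = ψ := by
  apply Ideal.Quotient.ringHom_ext
  apply MvPolynomial.ringHom_ext
  · intro n
    simp
  · rintro ⟨hX, f⟩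
    exact h hX f

end Hom

variable {G Ω : Type u} [Group G] [MulAction G Ω]

/-! ### The 2-adic measure -/

section Dyadic

theorem exists_dyadic_homs (hG : IsOligomorphic G Ω) (hIND : IND G Ω 1) (hodd : IsOdd G Ω) :
    ∃ φ : ∀ n : ℕ, Theta (stabClass G Ω) →+* ZMod (2 ^ (n + 1)),
      (∀ n, (ZMod.castHom (pow_dvd_pow 2 (n + 1).le_succ) (ZMod (2 ^ (n + 1)))).comp (φ (n + 1)) =
        φ n) ∧
      ∀ {X Y : GSet (stabClass G Ω)} (_ : Y.IsTransitive) (hX : X.IsTransitive) (f : Y →[G] X),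
        φ 0 (Theta.cls hX f) = 1 := by
  choose L hL using fun (n : ℕ) (μ : Measure (stabClass G Ω) (ZMod (2 ^ (n + 1)))) =>
    μ.exists_lift hG hIND (dvd_pow_self 2 n.succ_ne_zero) (pow_succ' 2 (n + 1))
  let μ₀ : Measure (stabClass G Ω) (ZMod (2 ^ (0 + 1))) := parityMeasure hodd _ (by decide)
  let μ : ∀ n : ℕ, Measure (stabClass G Ω) (ZMod (2 ^ (n + 1))) := fun n =>
    Nat.rec μ₀ (fun n ν => L n ν) n
  refine ⟨fun n => (μ n).toHom, fun n => Theta.hom_ext fun {X Y} hX f => ?_,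
    fun {X Y} hY hX f => ?_⟩
  · rw [RingHom.comp_apply, Measure.toHom_cls, Measure.toHom_cls]
    exact hL n (μ n) _ hX f
  · rw [Measure.toHom_cls]
    change (Nat.card (orbitRel.Quotient G Y) : ZMod (2 ^ (0 + 1))) = 1
    rw [card_orbits_of_isTransitive hY, Nat.cast_one]

theorem exists_padic_measure (hG : IsOligomorphic G Ω) (hIND : IND G Ω 1) (hodd : IsOdd G Ω) :
    ∃ ν : Measure (stabClass G Ω) ℚ_[2],
      ∀ {X Y : GSet (stabClass G Ω)} (_ : Y.IsTransitive) (hX : X.IsTransitive) (f : Y →[G] X),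
        ν.val hX f ≠ 0 := by
  obtain ⟨φ, hφ, hφ₀⟩ := exists_dyadic_homs hG hIND hodd
  -- The tower φ starts at modulus 2, while `PadicInt.lift` expects one starting at modulus 1, so
  -- each map is reduced by one level.
  let ψ : ∀ n, Theta (stabClass G Ω) →+* ZMod (2 ^ n) := fun n =>
    (ZMod.castHom (pow_dvd_pow 2 n.le_succ) (ZMod (2 ^ n))).comp (φ n)
  have hψ : ∀ (m n : ℕ) (h : m ≤ n),
      (ZMod.castHom (pow_dvd_pow 2 h) (ZMod (2 ^ m))).comp (ψ n) = ψ m := by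
    intro m n h
    induction n, h using Nat.le_induction with
    | base =>
      rw [← RingHom.comp_assoc]
      congr 1
      exact Subsingleton.elim _ _
    | succ n h ih =>
      rw [← ih]
      change _ = (ZMod.castHom _ _).comp ((ZMod.castHom _ _).comp (φ n))
      rw [← hφ n, ← RingHom.comp_assoc, ← RingHom.comp_assoc, ← RingHom.comp_assoc]
      congr 1
      exact Subsingleton.elim _ _
  refine ⟨Measure.ofHom (PadicInt.Coe.ringHom.comp (PadicInt.lift hψ)), ?_⟩
  intro X Y hY hX f h0
  have h1 : PadicInt.lift hψ (Theta.cls hX f) = 0 := Subtype.ext h0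
  have h2 := congrArg (PadicInt.toZModPow 1) h1
  rw [map_zero, ← RingHom.comp_apply, PadicInt.lift_spec] at h2
  have h3 : ψ 1 = φ 0 := hφ 0
  rw [h3, hφ₀ hY] at h2
  exact absurd (show (1 : ZMod 2) = 0 from h2) (by decide)

end Dyadic

/-- Inverting only 1 changes nothing; this turns GEN(1) into finite generation over ℤ. -/
theorem finite_of_finite_localizedModule {R M : Type*} [CommRing R] [AddCommGroup M] [Module R M]
    (S : Submonoid R) (hone : ∀ s : S, s = 1)
    (h : Module.Finite (Localization S) (LocalizedModule S M)) : Module.Finite R M := by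
  have h1 : Module.Finite R (Localization S) := by
    refine Module.Finite.of_surjective (Algebra.linearMap R (Localization S)) fun x => ?_
    obtain ⟨a, s, rfl⟩ := IsLocalization.exists_mk'_eq S x
    refine ⟨a, ?_⟩
    rw [hone s, IsLocalization.mk'_one]
    rfl
  have h2 : Module.Finite R (LocalizedModule S M) := Module.Finite.trans (Localization S) _
  have hbij : Function.Bijective (LocalizedModule.mkLinearMap S M) := by
    constructor
    · intro a b hab
      obtain ⟨s, hs⟩ := LocalizedModule.mk_eq.1 hab
      rw [hone s] at hs
      simpa using hs
    · intro x
      induction x using LocalizedModule.induction_on with | h m s => ?_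
      rw [hone s]
      exact ⟨m, rfl⟩
  exact Module.Finite.equiv (LinearEquiv.ofBijective _ hbij).symm

theorem GEN.fg (h : GEN G Ω 1) : (ThetaLEOne G Ω).FG := by
  rw [← Module.Finite.iff_fg]
  refine finite_of_finite_localizedModule (Submonoid.powers ((1 : ℕ) : ℤ)) ?_ h
  rintro ⟨_, n, rfl⟩
  exact Subtype.ext (by simp)

end Oligo

namespace Oligo

open MulAction

/-! ### Rational numbers constrained at every prime -/

section Rational

/-- The products of `n` elements of a set. -/
def productsOfLength {R : Type*} [CommRing R] (B : Set R) (n : ℕ) : Set R :=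
  {s | ∃ L : List R, L.length = n ∧ (∀ v ∈ L, v ∈ B) ∧ s = L.prod}

theorem padicNorm_le_of_mem_closure {p : ℕ} [Fact p.Prime] {B : Set ℚ} {C : ℚ} (hC : 0 ≤ C)
    (hB : ∀ v ∈ B, padicNorm p v ≤ C) {n : ℕ} {s : ℚ}
    (hs : s ∈ AddSubgroup.closure (productsOfLength B n)) : padicNorm p s ≤ C ^ n := by
  induction hs using AddSubgroup.closure_induction with
  | mem s hs =>
    obtain ⟨L, rfl, hL, rfl⟩ := hs
    induction L with
    | nil => simp
    | cons a L ih =>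
      rw [List.prod_cons, padicNorm.mul, List.length_cons, pow_succ']
      exact mul_le_mul (hB a (hL a (by simp))) (ih fun v hv => hL v (by simp [hv]))
        (padicNorm.nonneg _) hC
  | zero => simpa using pow_nonneg hC n
  | add s t _ _ h1 h2 => exact padicNorm.nonarchimedean.trans (max_le h1 h2)
  | neg s _ h => rwa [padicNorm.neg]

/-- The common denominator bounds the valuations below, and a set of integers bounded below has a
least element. -/
theorem exists_maximal_padicNorm {p : ℕ} [hp : Fact p.Prime] {B : Set ℚ} (h0 : (0 : ℚ) ∉ B)
    {r : ℤ} (hr : r ≠ 0) (hB : ∀ v ∈ B, ∃ m : ℤ, r * v = m) (hne : B.Nonempty) :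
    ∃ u ∈ B, ∀ v ∈ B, padicNorm p v ≤ padicNorm p u := by
  obtain ⟨_, ⟨u, hu, rfl⟩, hmin⟩ := Int.exists_least_of_bdd
    (P := fun z => ∃ u ∈ B, padicValRat p u = z) ⟨-padicValRat p (r : ℚ), by
      rintro _ ⟨v, hv, rfl⟩
      obtain ⟨m, hm⟩ := hB v hv
      have hv0 : v ≠ 0 := fun h => h0 (h ▸ hv)
      have := padicValRat.mul (p := p) (Int.cast_ne_zero.2 hr : (r : ℚ) ≠ 0) hv0
      rw [hm, padicValRat.of_int] at this
      have h2 : (0 : ℤ) ≤ (padicValInt p m : ℤ) := Int.natCast_nonneg _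
      omega⟩ ⟨_, hne.some, hne.some_mem, rfl⟩
  refine ⟨u, hu, fun v hv => ?_⟩
  have hv0 : v ≠ 0 := fun h => h0 (h ▸ hv)
  have hu0 : u ≠ 0 := fun h => h0 (h ▸ hu)
  rw [padicNorm.eq_zpow_of_nonzero hv0, padicNorm.eq_zpow_of_nonzero hu0]
  exact zpow_le_zpow_right₀ (by exact_mod_cast hp.out.one_le) (neg_le_neg (hmin _ ⟨v, hv, rfl⟩))

/-- Take n = p - 1, so that the left side carries p!, of norm below 1. If the maximal norm C on B
exceeded 1, the right side for an element attaining it would have norm C^(p-1), while |s| ≤ C^(p-1).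
Once C ≤ 1, an element u of norm below 1 would make each u - i with 0 < i < p a unit, while |s| ≤ 1.
Both are contradictions. -/
theorem padicNorm_eq_one_of_factorial_mul_eq {p : ℕ} [hp : Fact p.Prime] {B : Set ℚ}
    (h0 : (0 : ℚ) ∉ B) {r : ℤ} (hr : r ≠ 0) (hB : ∀ v ∈ B, ∃ m : ℤ, r * v = m)
    (H : ∀ u ∈ B, ∀ n : ℕ, ∃ s ∈ AddSubgroup.closure (productsOfLength B n),
      ((n + 1).factorial : ℚ) * s = ∏ i ∈ Finset.range n, (u - ((i : ℚ) + 1))) :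
    ∀ u ∈ B, padicNorm p u = 1 := by
  intro u hu
  obtain ⟨u₀, hu₀, hmax⟩ := exists_maximal_padicNorm (p := p) h0 hr hB ⟨u, hu⟩
  have hp1 : p - 1 + 1 = p := Nat.sub_add_cancel hp.out.one_le
  have hfact : padicNorm p (p.factorial : ℚ) < 1 := by
    rw [padicNorm.nat_lt_one_iff]
    exact hp.out.dvd_factorial.2 le_rfl
  have hprod : ∀ v c : ℚ, (∀ i < p - 1, padicNorm p (v - ((i : ℚ) + 1)) = c) →
      padicNorm p (∏ i ∈ Finset.range (p - 1), (v - ((i : ℚ) + 1))) = c ^ (p - 1) := by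
    intro v c h
    have : ∀ n ≤ p - 1, padicNorm p (∏ i ∈ Finset.range n, (v - ((i : ℚ) + 1))) = c ^ n := by
      intro n hn
      induction n with
      | zero => simp
      | succ n ih =>
        rw [Finset.prod_range_succ, padicNorm.mul, ih (by omega), h n (by omega), pow_succ]
    exact this _ le_rfl
  have hle : padicNorm p u₀ ≤ 1 := by
    by_contra hlt
    rw [not_le] at hlt
    obtain ⟨s, hs, hs'⟩ := H u₀ hu₀ (p - 1)
    rw [hp1] at hs'
    have h1 := padicNorm_le_of_mem_closure (padicNorm.nonneg u₀) hmax hs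
    have h2 : padicNorm p ((p.factorial : ℚ) * s) = padicNorm p u₀ ^ (p - 1) := by
      rw [hs']
      refine hprod u₀ _ fun i _ => ?_
      have hi : padicNorm p (-((i : ℚ) + 1)) < padicNorm p u₀ := by
        rw [padicNorm.neg]
        refine lt_of_le_of_lt ?_ hlt
        have := padicNorm.of_nat (p := p) (i + 1)
        exact_mod_cast this
      rw [sub_eq_add_neg, padicNorm.add_eq_max_of_ne hi.ne', max_eq_left hi.le]
    rw [padicNorm.mul] at h2
    have h3 : 0 < padicNorm p u₀ ^ (p - 1) := pow_pos (zero_lt_one.trans hlt) _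
    have h4 := padicNorm.nonneg (p := p) (p.factorial : ℚ)
    nlinarith
  by_contra hne
  have hlt : padicNorm p u < 1 := lt_of_le_of_ne ((hmax u hu).trans hle) hne
  obtain ⟨s, hs, hs'⟩ := H u hu (p - 1)
  rw [hp1] at hs'
  have h1 := padicNorm_le_of_mem_closure zero_le_one (fun v hv => (hmax v hv).trans hle) hs
  have h2 : padicNorm p ((p.factorial : ℚ) * s) = 1 ^ (p - 1) := by
    rw [hs']
    refine hprod u _ fun i hi => ?_
    have hi1 : padicNorm p (-((i : ℚ) + 1)) = 1 := by
      rw [padicNorm.neg]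
      have := (padicNorm.nat_eq_one_iff (p := p) (i + 1)).2 fun hdvd =>
        absurd (Nat.le_of_dvd i.succ_pos hdvd) (by omega)
      exact_mod_cast this
    rw [sub_eq_add_neg, padicNorm.add_eq_max_of_ne (by rw [hi1]; exact hlt.ne), hi1,
      max_eq_right hlt.le]
  rw [one_pow] at h1 h2
  rw [padicNorm.mul] at h2
  have h4 := padicNorm.nonneg (p := p) (p.factorial : ℚ)
  have h5 := padicNorm.nonneg (p := p) s
  nlinarith

theorem eq_one_or_neg_one_of_padicNorm_eq_one {q : ℚ}
    (h : ∀ p : ℕ, ∀ _ : Fact p.Prime, padicNorm p q = 1) : q = 1 ∨ q = -1 := by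
  have key : ∀ p : ℕ, p.Prime → (p ∣ q.num.natAbs ↔ p ∣ q.den) := by
    intro p hp
    have := Fact.mk hp
    have h1 : padicNorm p (q.num : ℚ) = padicNorm p (q.den : ℚ) := by
      have h2 : (q.num : ℚ) = q * q.den := (Rat.mul_den_eq_num q).symm
      rw [h2, padicNorm.mul, h p this, one_mul]
    rw [← Int.natCast_dvd, ← padicNorm.int_lt_one_iff, ← padicNorm.nat_lt_one_iff, h1]
  have hcop := q.reduced
  have hnum : q.num.natAbs = 1 := by
    by_contra hne
    obtain ⟨p, hp, hdvd⟩ := Nat.exists_prime_and_dvd hne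
    exact hp.one_lt.ne' (Nat.dvd_one.1 (hcop ▸ Nat.dvd_gcd hdvd ((key p hp).1 hdvd)))
  have hden : q.den = 1 := by
    by_contra hne
    obtain ⟨p, hp, hdvd⟩ := Nat.exists_prime_and_dvd hne
    exact hp.one_lt.ne' (Nat.dvd_one.1 (hcop ▸ Nat.dvd_gcd ((key p hp).2 hdvd) hdvd))
  have hq : q = q.num := by
    conv_lhs => rw [← Rat.num_div_den q, hden]
    simp
  rcases Int.natAbs_eq_iff.1 hnum with h1 | h1 <;> rw [hq, h1] <;> simp

end Rational

end Oligo

/-! ### Basic maps and their values -/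

namespace Oligo

open MulAction

variable {G Ω : Type u} [Group G] [MulAction G Ω]

theorem exists_bijective_of_stabilizer_eq {A B : Type*} [MulAction G A] [MulAction G B]
    [IsPretransitive G A] [IsPretransitive G B] {a : A} {b : B}
    (h : stabilizer G a = stabilizer G b) : ∃ i : A →[G] B, Function.Bijective i ∧ i a = b := by
  obtain ⟨i, hi⟩ := exists_smul_eq_of_stabilizer_le h.le
  refine ⟨i, ⟨?_, ?_⟩, hi⟩
  · intro x y hxy
    obtain ⟨g, rfl⟩ := exists_smul_eq G a x
    obtain ⟨c, rfl⟩ := exists_smul_eq G a y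
    rw [map_smul, map_smul, hi, ← inv_smul_eq_iff, ← mul_smul, ← mem_stabilizer_iff, ← h,
      mem_stabilizer_iff, mul_smul, inv_smul_eq_iff] at hxy
    exact hxy
  · intro y
    obtain ⟨g, rfl⟩ := exists_smul_eq G b y
    exact ⟨g • a, by rw [map_smul, hi]⟩

theorem stabilizer_le_stabilizer_map {A B : Type*} [MulAction G A] [MulAction G B] (f : A →[G] B)
    (a : A) : stabilizer G a ≤ stabilizer G (f a) := by
  intro g hg
  rw [mem_stabilizer_iff] at hg ⊢
  rw [← map_smul, hg]

/-- A map is simple if the stabilizer of some point of the source is cut out in the stabilizer of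
its image by fixing one point of `Ω`. -/
def IsSimpleMap {X Y : GSet (stabClass G Ω)} (f : Y →[G] X) : Prop :=
  ∃ (y : Y) (ω : Ω), stabilizer G y = stabilizer G (f y) ⊓ stabilizer G ω

section Basic

variable {k : Type*} [CommRing k] (μ : Measure (stabClass G Ω) k)

/-- The values of a measure on the basic maps. -/
def Measure.basicValues : Set k :=
  {u | ∃ (l : ℕ) (a : Fin (l + 1) → Ω),
    u = μ.val (orbitGSet_isTransitive G (Fin.init a)) (basicMap G a)}

theorem stabilizer_orbitGSet {n : ℕ} (a : Fin n → Ω) (x : orbitGSet G a) :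
    stabilizer G x = stabilizer G x.1 := by
  ext g
  rw [mem_stabilizer_iff, mem_stabilizer_iff]
  exact Subtype.ext_iff

theorem isSimpleMap_basicMap {l : ℕ} (a : Fin (l + 1) → Ω) : IsSimpleMap (basicMap G a) := by
  refine ⟨⟨a, mem_orbit_self a⟩, a (Fin.last l), ?_⟩
  refine (stabilizer_orbitGSet a _).trans (Eq.trans ?_ (congrArg (· ⊓ stabilizer G (a (Fin.last l)))
    (stabilizer_orbitGSet (Fin.init a : Fin l → Ω) _).symm))
  change stabilizer G a = stabilizer G (Fin.init a : Fin l → Ω) ⊓ stabilizer G (a (Fin.last l))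
  ext g
  rw [Subgroup.mem_inf, mem_stabilizer_iff, mem_stabilizer_iff, mem_stabilizer_iff]
  constructor
  · intro h
    exact ⟨funext fun i => congrFun h i.castSucc, congrFun h _⟩
  · rintro ⟨h1, h2⟩
    funext i
    refine Fin.lastCases ?_ (fun i => ?_) i
    · exact h2
    · exact congrFun h1 i

/-- Transitive sets are determined by a point stabilizer. With b a tuple whose stabilizer is that of
f y, the map f is isomorphic to the basic map of the tuple (b, ω). -/
theorem Measure.val_mem_basicValues {X Y : GSet (stabClass G Ω)} (hY : Y.IsTransitive)
    (hX : X.IsTransitive) {f : Y →[G] X} (hf : IsSimpleMap f) :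
    μ.val hX f ∈ μ.basicValues := by
  obtain ⟨y, ω, h⟩ := hf
  obtain ⟨l, b, hb⟩ := exists_tuple_of_mem_stabClass (X.smooth (f y))
  let a : Fin (l + 1) → Ω := Fin.snoc b ω
  have hinit : (Fin.init a : Fin l → Ω) = b := Fin.init_snoc _ _
  refine ⟨l, a, ?_⟩
  let y₀ : orbitGSet G a := ⟨a, mem_orbit_self a⟩
  let x₀ : orbitGSet G (Fin.init a : Fin l → Ω) := ⟨Fin.init a, mem_orbit_self _⟩
  have hx₀ : stabilizer G x₀ = stabilizer G (f y) := by
    rw [stabilizer_orbitGSet, ← hb]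
    change stabilizer G (Fin.init a : Fin l → Ω) = _
    rw [hinit]
  have hy₀ : stabilizer G y₀ = stabilizer G y := by
    rw [stabilizer_orbitGSet, h, ← hb]
    change stabilizer G a = _
    ext g
    rw [Subgroup.mem_inf, mem_stabilizer_iff, mem_stabilizer_iff, mem_stabilizer_iff]
    constructor
    · intro h
      refine ⟨funext fun i => ?_, ?_⟩
      · simpa [a] using congrFun h i.castSucc
      · simpa [a] using congrFun h (Fin.last l)
    · rintro ⟨h1, h2⟩
      funext i
      refine Fin.lastCases ?_ (fun i => ?_) i
      · simpa [a] using h2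
      · simpa [a] using congrFun h1 i
  have := hY.2
  have := hX.2
  have := (orbitGSet_isTransitive G a).2
  have := (orbitGSet_isTransitive G (Fin.init a : Fin l → Ω)).2
  obtain ⟨i, hi, hiy⟩ := exists_bijective_of_stabilizer_eq hy₀
  obtain ⟨j, hj, hjx⟩ := exists_bijective_of_stabilizer_eq hx₀
  refine μ.val_iso_congr hX _ f (basicMap G a) i j hi hj fun z => ?_
  obtain ⟨g, rfl⟩ := exists_smul_eq G y₀ z
  rw [map_smul, map_smul, map_smul, map_smul, hiy]
  congr 1
  exact hjx.symm

end Basic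

/-! ### Divisibility relations among basic values -/

section Products

variable (hG : IsOligomorphic G Ω) (hIND : IND G Ω 1) {k : Type*} [CommRing k]
  (μ : Measure (stabClass G Ω) k)

/-- Removing points from a subset one at a time gives a chain of simple maps between orbits, ending
in the one-element subsets, which are a copy of Y. -/
theorem Measure.val_orbit_subsets {X Y : GSet (stabClass G Ω)} (hY : Y.IsTransitive)
    (hX : X.IsTransitive) {f : Y →[G] X} (hf : IsSimpleMap f) (n : ℕ)
    (q : orbitRel.Quotient G (GSet.subsets hG hIND f (n + 1))) :
    ∃ s ∈ productsOfLength μ.basicValues n,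
      μ.val hX ((subsetsProj hG hIND f (n + 1)).comp (GSet.incl _ (orbitSub q))) =
        μ.val hX f * s := by
  have := hY.2
  have hstab : ∀ (m : ℕ) (q : orbitRel.Quotient G (GSet.subsets hG hIND f m))
      (t : (GSet.subsets hG hIND f m).orb q),
      stabilizer G t = stabilizer G t.1.1.1 ⊓ fixingSubgroup G t.1.1.2 := by
    intro m q t
    rw [← stabilizer_fiberSubsets hG hIND (f := f) t.1]
    ext g
    exact Subtype.ext_iff
  have hsimple : ∀ y : Y, ∃ ω : Ω, stabilizer G y = stabilizer G (f y) ⊓ stabilizer G ω := by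
    intro y
    obtain ⟨y₀, ω, h⟩ := hf
    obtain ⟨g, rfl⟩ := exists_smul_eq G y₀ y
    refine ⟨g • ω, ?_⟩
    rw [map_smul, stabilizer_smul_eq_stabilizer_map_conj, stabilizer_smul_eq_stabilizer_map_conj,
      stabilizer_smul_eq_stabilizer_map_conj, h, Subgroup.map_inf_eq _ _ _ (MulEquiv.injective _)]
  induction n with
  | zero =>
    refine ⟨1, ⟨[], rfl, by simp, by simp⟩, ?_⟩
    rw [mul_one]
    have hT := GSet.orb_isTransitive _ q
    have := hT.2
    obtain ⟨t⟩ := hT.1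
    obtain ⟨y, hy⟩ := Set.encard_eq_one.1 (show t.1.1.2.encard = 1 from t.1.2.1)
    have hfy : f y = t.1.1.1 := t.1.2.2 y (hy ▸ rfl)
    have hst : stabilizer G t = stabilizer G y := by
      rw [hstab, hy, ← hfy]
      ext g
      have := @stabilizer_le_stabilizer_map G _ _ _ _ _ f y g
      simpa [mem_fixingSubgroup_iff] using this
    obtain ⟨i, hi, hit⟩ := exists_bijective_of_stabilizer_eq hst
    rw [μ.congr hX f i hi]
    congr 1
    ext s
    obtain ⟨g, rfl⟩ := exists_smul_eq G t s
    rw [map_smul, map_smul]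
    congr 1
    change t.1.1.1 = f (i t)
    rw [hit, hfy]
  | succ n ih =>
    have hT := GSet.orb_isTransitive _ q
    have := hT.2
    obtain ⟨t⟩ := hT.1
    have hne : t.1.1.2.Nonempty := by
      rw [← Set.encard_pos, t.1.2.1]
      exact_mod_cast (n + 1).succ_pos
    obtain ⟨y, hy⟩ := hne
    let t' : GSet.subsets hG hIND f (n + 1) := ⟨(t.1.1.1, t.1.1.2 \ {y}),
      encard_sdiff_singleton_of_encard_eq t.1.2.1 hy, fun z hz => t.1.2.2 z hz.1⟩
    let q' : orbitRel.Quotient G (GSet.subsets hG hIND f (n + 1)) := orbitClass t'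
    let t₀ : (GSet.subsets hG hIND f (n + 1)).orb q' := ⟨t', rfl⟩
    have hT' := GSet.orb_isTransitive _ q'
    have h1 : stabilizer G t = stabilizer G t₀ ⊓ stabilizer G y := by
      rw [hstab, hstab, inf_assoc]
      congr 1
      change fixingSubgroup G t.1.1.2 = fixingSubgroup G (t.1.1.2 \ {y}) ⊓ stabilizer G y
      ext g
      rw [Subgroup.mem_inf, mem_fixingSubgroup_iff, mem_fixingSubgroup_iff, mem_stabilizer_iff]
      constructor
      · intro h
        exact ⟨fun z hz => h z hz.1, h y hy⟩
      · rintro ⟨h1, h2⟩ z hz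
        by_cases hzy : z = y
        · rw [hzy, h2]
        · exact h1 z ⟨hz, hzy⟩
    obtain ⟨ω, hω⟩ := hsimple y
    -- The base point f y is part of the data of t₀, so restoring y costs only the fixing of ω.
    have hle : stabilizer G t₀ ≤ stabilizer G (f y) := by
      rw [hstab, t.1.2.2 y hy]
      exact inf_le_left
    have h2 : stabilizer G t = stabilizer G t₀ ⊓ stabilizer G ω := by
      rw [h1, hω, ← inf_assoc, inf_eq_left.2 hle]
    obtain ⟨p, hp⟩ := exists_smul_eq_of_stabilizer_le (h2.le.trans inf_le_left)
    have hps : IsSimpleMap p := ⟨t, ω, by rw [hp, h2]⟩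
    obtain ⟨s, ⟨L, hL, hLB, rfl⟩, hs⟩ := ih q'
    refine ⟨(μ.val hT' p :: L).prod, ⟨_, by simp [hL], ?_, rfl⟩, ?_⟩
    · intro v hv
      rcases List.mem_cons.1 hv with rfl | hv
      · exact μ.val_mem_basicValues hT hT' hps
      · exact hLB v hv
    · have hcomm : (subsetsProj hG hIND f (n + 1 + 1)).comp (GSet.incl _ (orbitSub q)) =
          ((subsetsProj hG hIND f (n + 1)).comp (GSet.incl _ (orbitSub q'))).comp p := by
        ext s
        obtain ⟨g, rfl⟩ := exists_smul_eq G t s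
        rw [map_smul, map_smul]
        congr 1
        change t.1.1.1 = ((p t).1).1.1
        rw [hp]
      rw [hcomm, μ.comp hT hT' hX, hs, List.prod_cons]
      ring

include hG hIND in
-- Sum the values of the orbits of (n+1)-element subsets. Each contains the factor μ(f), which is
-- also the first factor of the falling factorial and can be cancelled.
theorem Measure.exists_factorial_mul_eq [IsDomain k] {X Y : GSet (stabClass G Ω)}
    (hY : Y.IsTransitive) (hX : X.IsTransitive) {f : Y →[G] X} (hf : IsSimpleMap f)
    (hne : μ.val hX f ≠ 0) (n : ℕ) :
    ∃ s ∈ AddSubgroup.closure (productsOfLength μ.basicValues n),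
      ((n + 1).factorial : k) * s =
        ∏ i ∈ Finset.range n, (μ.val hX f - ((i : k) + 1)) := by
  classical
  have hfact : ∀ m : ℕ, (m.factorial : k) * μ.val hX (subsetsProj hG hIND f m) =
      ∏ i ∈ Finset.range m, (μ.val hX f - (i : k)) := by
    intro m
    induction m with
    | zero =>
      rw [μ.val_subsets_zero]
      simp
    | succ m ih =>
      have := μ.val_subsets_succ hG hIND f hX m
      rw [Finset.prod_range_succ, ← ih, Nat.factorial_succ]
      push_cast
      linear_combination (m.factorial : k) * this
  choose s hs hs' using μ.val_orbit_subsets hG hIND hY hX hf n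
  have := Fintype.ofFinite (orbitRel.Quotient G (GSet.subsets hG hIND f (n + 1)))
  refine ⟨∑ q, s q, sum_mem fun q _ => AddSubgroup.subset_closure (hs q), ?_⟩
  have h1 := hfact (n + 1)
  rw [(μ.isAdditive hX).sum_orb, Finset.sum_congr rfl fun q _ => hs' q, ← Finset.mul_sum,
    Finset.prod_range_succ'] at h1
  apply mul_left_cancel₀ hne
  rw [Nat.cast_zero, sub_zero] at h1
  push_cast at h1
  linear_combination h1

end Products

/-! ### Factoring maps of transitive sets into simple maps -/

section Chains

variable (hG : IsOligomorphic G Ω) {k : Type*} [CommRing k] (μ : Measure (stabClass G Ω) k)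

include hG in
-- The stabilizer of a point of Y is cut out in that of its image by a tuple in Ω. Fixing the
-- coordinates of the tuple one at a time factors f into simple maps.
theorem Measure.val_mem_closure_basicValues {X Y : GSet (stabClass G Ω)} (hY : Y.IsTransitive)
    (hX : X.IsTransitive) (f : Y →[G] X) :
    μ.val hX f ∈ Submonoid.closure μ.basicValues := by
  have key : ∀ (n : ℕ) (a : Fin n → Ω) (T : GSet (stabClass G Ω)) (_ : T.IsTransitive)
      (h : T →[G] X) (t : T), stabilizer G t = stabilizer G (h t) ⊓ stabilizer G a →
      μ.val hX h ∈ Submonoid.closure μ.basicValues := by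
    intro n
    induction n with
    | zero =>
      intro a T hT h t ht
      have h1 : stabilizer G t = stabilizer G (h t) := by
        rw [ht, inf_eq_left]
        intro g _
        exact funext fun i => i.elim0
      have := hT.2
      have := hX.2
      obtain ⟨i, hi, hit⟩ := exists_bijective_of_stabilizer_eq h1
      have : h = i := by
        ext s
        obtain ⟨g, rfl⟩ := exists_smul_eq G t s
        rw [map_smul, map_smul, hit]
      rw [this, μ.iso hX i hi]
      exact one_mem _
    | succ n ih =>
      intro a T hT h t ht
      let P := X.prod hG (orbitGSet G (Fin.init a : Fin n → Ω))
      let p₀ : P := (h t, ⟨Fin.init a, mem_orbit_self _⟩)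
      let T' := P.orb (orbitClass p₀)
      let t' : T' := ⟨p₀, rfl⟩
      have hT' : T'.IsTransitive := P.orb_isTransitive _
      have ht' : stabilizer G t' = stabilizer G (h t) ⊓ stabilizer G (Fin.init a : Fin n → Ω) := by
        ext g
        rw [Subgroup.mem_inf, mem_stabilizer_iff, mem_stabilizer_iff, mem_stabilizer_iff]
        refine Subtype.ext_iff.trans (Prod.ext_iff.trans ?_)
        exact and_congr_right fun _ => Subtype.ext_iff
      have hlast : stabilizer G a =
          stabilizer G (Fin.init a : Fin n → Ω) ⊓ stabilizer G (a (Fin.last n)) := by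
        ext g
        rw [Subgroup.mem_inf, mem_stabilizer_iff, mem_stabilizer_iff, mem_stabilizer_iff]
        constructor
        · intro h
          exact ⟨funext fun i => congrFun h i.castSucc, congrFun h _⟩
        · rintro ⟨h1, h2⟩
          funext i
          refine Fin.lastCases ?_ (fun i => ?_) i
          · exact h2
          · exact congrFun h1 i
      have htt : stabilizer G t = stabilizer G t' ⊓ stabilizer G (a (Fin.last n)) := by
        rw [ht, hlast, ht', inf_assoc]
      have := hT.2
      obtain ⟨p, hp⟩ := exists_smul_eq_of_stabilizer_le (htt.le.trans inf_le_left)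
      let h' : T' →[G] X := ⟨fun s => s.1.1, fun _ _ => rfl⟩
      have hcomm : h = h'.comp p := by
        ext s
        obtain ⟨g, rfl⟩ := exists_smul_eq G t s
        rw [map_smul, map_smul]
        congr 1
        change h t = h' (p t)
        rw [hp]
        rfl
      rw [hcomm, μ.comp hT hT' hX]
      refine mul_mem (ih (Fin.init a) T' hT' h' t' ht') (Submonoid.subset_closure ?_)
      exact μ.val_mem_basicValues hT hT' ⟨t, a (Fin.last n), by rw [hp, htt]⟩
  obtain ⟨y⟩ := hY.1
  obtain ⟨n, a, ha⟩ := exists_tuple_of_mem_stabClass (Y.smooth y)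
  refine key n a Y hY f y ?_
  rw [ha, eq_comm, inf_eq_right]
  exact stabilizer_le_stabilizer_map f y

end Chains

end Oligo

namespace Oligo

open MulAction

variable {G Ω : Type u} [Group G] [MulAction G Ω]

/-! ### The 2-adic measure takes the values ±1 -/

section Existence

variable {k : Type*} [Field k] (μ : Measure (stabClass G Ω) k)

/-- Let M be the image of Θ_{≤1} in k/ℤ. The hypothesis gives M = 2M, and M is finitely generated,
so by Nakayama some r ≡ 1 mod 2 kills M. -/
theorem Measure.exists_denominator (hfg : (ThetaLEOne G Ω).FG)
    (h : ∀ u ∈ μ.basicValues, ∃ s ∈ AddSubgroup.closure μ.basicValues, u = 1 + 2 * s) :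
    ∃ r : ℤ, r ≠ 0 ∧ ∀ u ∈ μ.basicValues, ∃ m : ℤ, r * u = m := by
  let φ : Theta (stabClass G Ω) →ₗ[ℤ] k :=
    { toFun := μ.toHom
      map_add' := map_add μ.toHom
      map_smul' := fun n x => by
        rw [eq_intCast, zsmul_eq_mul, zsmul_eq_mul, map_mul, map_intCast]
        rfl }
  let ψ := (Submodule.span ℤ {(1 : k)}).mkQ.comp φ
  have hψ : ∀ (l : ℕ) (a : Fin (l + 1) → Ω),
      ψ (Theta.cls (orbitGSet_isTransitive G (Fin.init a)) (basicMap G a)) =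
        (Submodule.span ℤ {(1 : k)}).mkQ
          (μ.val (orbitGSet_isTransitive G (Fin.init a)) (basicMap G a)) := fun l a =>
    congrArg (Submodule.span ℤ {(1 : k)}).mkQ
      (μ.toHom_cls (orbitGSet_isTransitive G (Fin.init a)) (basicMap G a))
  have hmem : ∀ u ∈ μ.basicValues, (Submodule.span ℤ {(1 : k)}).mkQ u ∈
      (ThetaLEOne G Ω).map ψ := by
    rintro _ ⟨l, a, rfl⟩
    refine ⟨Theta.cls (orbitGSet_isTransitive G (Fin.init a)) (basicMap G a),
      Submodule.subset_span ⟨l, a, rfl⟩, ?_⟩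
    exact hψ l a
  have hle : (ThetaLEOne G Ω).map ψ ≤ Ideal.span {(2 : ℤ)} • (ThetaLEOne G Ω).map ψ := by
    rw [ThetaLEOne, Submodule.map_span, Submodule.span_le, ← Submodule.map_span, ← ThetaLEOne]
    rintro _ ⟨_, ⟨l, a, rfl⟩, rfl⟩
    obtain ⟨s, hs, hu⟩ := h _ ⟨l, a, rfl⟩
    have h1 : ψ (Theta.cls (orbitGSet_isTransitive G (Fin.init a)) (basicMap G a)) =
        (2 : ℤ) • (Submodule.span ℤ {(1 : k)}).mkQ s := by
      rw [hψ, hu, map_add, ← map_smul]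
      have : (Submodule.span ℤ {(1 : k)}).mkQ 1 = 0 := by
        rw [Submodule.mkQ_apply, Submodule.Quotient.mk_eq_zero]
        exact Submodule.mem_span_singleton_self 1
      rw [this, zero_add, zsmul_eq_mul]
      norm_num
    rw [SetLike.mem_coe, h1]
    refine Submodule.smul_mem_smul (Ideal.mem_span_singleton_self 2) ?_
    clear hu h1
    induction hs using AddSubgroup.closure_induction with
    | mem s hs => exact hmem s hs
    | zero => rw [map_zero]; exact zero_mem _
    | add s t _ _ h1 h2 => rw [map_add]; exact add_mem h1 h2
    | neg s _ h1 => rw [map_neg]; exact neg_mem h1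
  obtain ⟨r, hr, hr'⟩ := Submodule.exists_sub_one_mem_and_smul_eq_zero_of_fg_of_le_smul
    (Ideal.span {(2 : ℤ)}) ((ThetaLEOne G Ω).map ψ) (hfg.map ψ) hle
  refine ⟨r, ?_, fun u hu => ?_⟩
  · rintro rfl
    obtain ⟨c, hc⟩ := Ideal.mem_span_singleton.1 hr
    omega
  · have h1 := hr' _ (hmem u hu)
    rw [← map_smul, Submodule.mkQ_apply, Submodule.Quotient.mk_eq_zero,
      Submodule.mem_span_singleton] at h1
    obtain ⟨m, hm⟩ := h1
    exact ⟨m, by rw [← zsmul_eq_mul, ← hm, zsmul_eq_mul, mul_one]⟩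

variable [CharZero k]

theorem exists_rat_of_mem_closure {B : Set k} (hB : ∀ u ∈ B, ∃ q : ℚ, (q : k) = u) {n : ℕ} {s : k}
    (hs : s ∈ AddSubgroup.closure (productsOfLength B n)) :
    ∃ t ∈ AddSubgroup.closure (productsOfLength {q : ℚ | (q : k) ∈ B} n), (t : k) = s := by
  induction hs using AddSubgroup.closure_induction with
  | mem s hs =>
    obtain ⟨L, hL, hLB, rfl⟩ := hs
    suffices h : ∃ L' : List ℚ, L'.length = L.length ∧ (∀ v ∈ L', (v : k) ∈ B) ∧
        ((L'.prod : ℚ) : k) = L.prod by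
      obtain ⟨L', h1, h2, h3⟩ := h
      exact ⟨L'.prod, AddSubgroup.subset_closure ⟨L', h1.trans hL, h2, rfl⟩, h3⟩
    clear hL
    induction L with
    | nil => exact ⟨[], rfl, by simp, by simp⟩
    | cons a L ih =>
      obtain ⟨L', h1, h2, h3⟩ := ih fun v hv => hLB v (by simp [hv])
      obtain ⟨q, hq⟩ := hB a (hLB a (by simp))
      refine ⟨q :: L', by simp [h1], ?_, by simp [hq, h3]⟩
      intro v hv
      rcases List.mem_cons.1 hv with rfl | hv
      · rw [hq]
        exact hLB a (by simp)
      · exact h2 v hv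
  | zero => exact ⟨0, zero_mem _, Rat.cast_zero⟩
  | add s t _ _ h1 h2 =>
    obtain ⟨s', hs', rfl⟩ := h1
    obtain ⟨t', ht', rfl⟩ := h2
    exact ⟨s' + t', add_mem hs' ht', Rat.cast_add _ _⟩
  | neg s _ h =>
    obtain ⟨s', hs', rfl⟩ := h
    exact ⟨-s', neg_mem hs', Rat.cast_neg _⟩

variable (hG : IsOligomorphic G Ω) (hIND : IND G Ω 1)
include hG hIND

theorem Measure.basicValues_eq (hfg : (ThetaLEOne G Ω).FG)
    (hne : ∀ {X Y : GSet (stabClass G Ω)} (_ : Y.IsTransitive) (hX : X.IsTransitive)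
      (f : Y →[G] X), μ.val hX f ≠ 0) : ∀ u ∈ μ.basicValues, u = 1 ∨ u = -1 := by
  have hfact : ∀ u ∈ μ.basicValues, ∀ n : ℕ,
      ∃ s ∈ AddSubgroup.closure (productsOfLength μ.basicValues n),
        ((n + 1).factorial : k) * s = ∏ i ∈ Finset.range n, (u - ((i : k) + 1)) := by
    rintro _ ⟨l, a, rfl⟩ n
    exact μ.exists_factorial_mul_eq hG hIND (orbitGSet_isTransitive G a) _
      (isSimpleMap_basicMap a) (hne (orbitGSet_isTransitive G a) _ _) n
  have h0 : (0 : k) ∉ μ.basicValues := by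
    rintro ⟨l, a, h⟩
    exact hne (orbitGSet_isTransitive G a) _ _ h.symm
  -- The relation for n = 1 reads 2s = u - 1, with s in the group generated by the basic values.
  obtain ⟨r, hr, hden⟩ := μ.exists_denominator hfg fun u hu => by
    obtain ⟨s, hs, hsu⟩ := hfact u hu 1
    have hprod : productsOfLength μ.basicValues 1 ⊆ μ.basicValues := by
      rintro _ ⟨L, hL, hLB, rfl⟩
      obtain ⟨v, rfl⟩ := List.length_eq_one_iff.1 hL
      rw [List.prod_singleton]
      exact hLB v (by simp)
    refine ⟨s, AddSubgroup.closure_mono hprod hs, ?_⟩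
    simp only [Finset.prod_range_one, Nat.cast_zero, zero_add, Nat.factorial] at hsu
    push_cast at hsu
    linear_combination -hsu
  have hrat : ∀ u ∈ μ.basicValues, ∃ q : ℚ, (q : k) = u := by
    intro u hu
    obtain ⟨m, hm⟩ := hden u hu
    have hr' : (r : k) ≠ 0 := Int.cast_ne_zero.2 hr
    refine ⟨m / r, ?_⟩
    push_cast
    rw [← hm, mul_div_cancel_left₀ _ hr']
  intro u hu
  obtain ⟨q, rfl⟩ := hrat u hu
  have hq : q = 1 ∨ q = -1 := by
    apply eq_one_or_neg_one_of_padicNorm_eq_one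
    intro p hp
    refine padicNorm_eq_one_of_factorial_mul_eq (B := {q : ℚ | (q : k) ∈ μ.basicValues})
      (fun h => h0 (by simpa using h)) hr (fun v hv => ?_) (fun v hv n => ?_) q hu
    · obtain ⟨m, hm⟩ := hden _ hv
      exact ⟨m, by exact_mod_cast hm⟩
    · obtain ⟨s, hs, hsv⟩ := hfact _ hv n
      obtain ⟨t, ht, rfl⟩ := exists_rat_of_mem_closure hrat hs
      exact ⟨t, ht, by exact_mod_cast hsv⟩
  rcases hq with rfl | rfl <;> simp

theorem Measure.val_eq_one_or_neg_one (hfg : (ThetaLEOne G Ω).FG)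
    (hne : ∀ {X Y : GSet (stabClass G Ω)} (_ : Y.IsTransitive) (hX : X.IsTransitive)
      (f : Y →[G] X), μ.val hX f ≠ 0) {X Y : GSet (stabClass G Ω)} (hY : Y.IsTransitive)
    (hX : X.IsTransitive) (f : Y →[G] X) : μ.val hX f = 1 ∨ μ.val hX f = -1 := by
  have h := μ.val_mem_closure_basicValues hG hY hX f
  generalize μ.val hX f = u at h
  induction h using Submonoid.closure_induction with
  | mem u hu => exact μ.basicValues_eq hG hIND hfg hne u hu
  | one => exact Or.inl rfl
  | mul u v _ _ h1 h2 => rcases h1 with rfl | rfl <;> rcases h2 with rfl | rfl <;> simp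

end Existence

/-- A measure with values in the image of the integers comes from an integral measure. -/
theorem Measure.exists_int_measure {E : Set (Subgroup G)} {k : Type*} [CommRing k] [CharZero k]
    (μ : Measure E k)
    (h : ∀ {X Y : GSet E} (hX : X.IsTransitive) (f : Y →[G] X), ∃ m : ℤ, (m : k) = μ.val hX f) :
    ∃ μ' : Measure E ℤ, ∀ {X Y : GSet E} (hX : X.IsTransitive) (f : Y →[G] X),
      ((μ'.val hX f : ℤ) : k) = μ.val hX f := by
  choose v hv using @h
  refine ⟨{ val := fun hX f => v hX f, iso := ?_, add := ?_, comp := ?_, baseChange := ?_ },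
    fun hX f => hv hX f⟩
  · intro Y X hX f hf
    apply Int.cast_injective (α := k)
    rw [hv, μ.iso hX f hf, Int.cast_one]
  · intro Y Y₁ Y₂ X hX f i₁ i₂ h
    apply Int.cast_injective (α := k)
    rw [Int.cast_add, hv, hv, hv, μ.add hX f i₁ i₂ h]
  · intro Z Y X hZ hY hX f g
    apply Int.cast_injective (α := k)
    rw [Int.cast_mul, hv, hv, hv, μ.comp hZ hY hX f g]
  · intro X Y X' Y' hX hX' f g f' g' h
    apply Int.cast_injective (α := k)
    rw [hv, hv, μ.baseChange hX hX' f g f' g' h]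

theorem exists_regular_measure (hG : IsOligomorphic G Ω) (hGEN : GEN G Ω 1) (hIND : IND G Ω 1)
    (hodd : IsOdd G Ω) : ∃ μ : Measure (stabClass G Ω) ℤ, μ.IsRegular := by
  obtain ⟨ν, hν⟩ := exists_padic_measure hG hIND hodd
  have hpm : ∀ {X Y : GSet (stabClass G Ω)} (_ : Y.IsTransitive) (hX : X.IsTransitive)
      (f : Y →[G] X), ν.val hX f = 1 ∨ ν.val hX f = -1 := fun hY hX f =>
    ν.val_eq_one_or_neg_one hG hIND hGEN.fg hν hY hX f
  obtain ⟨μ, hμ⟩ := ν.exists_int_measure fun {X Y} hX f => by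
    classical
    have := Fintype.ofFinite (orbitRel.Quotient G Y)
    have h : ∀ q : orbitRel.Quotient G Y, ∃ m : ℤ,
        (m : ℚ_[2]) = ν.val hX (f.comp (Y.incl (orbitSub q))) := by
      intro q
      rcases hpm (Y.orb_isTransitive q) hX (f.comp (Y.incl (orbitSub q))) with h | h
      · exact ⟨1, by rw [h, Int.cast_one]⟩
      · exact ⟨-1, by rw [h, Int.cast_neg, Int.cast_one]⟩
    choose m hm using h
    refine ⟨∑ q, m q, ?_⟩
    rw [(ν.isAdditive hX).sum_orb, Int.cast_sum]
    exact Finset.sum_congr rfl fun q _ => hm q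
  refine ⟨μ, fun {Y X} hY hX f => ?_⟩
  rw [Int.isUnit_iff]
  have h := hμ hX f
  rcases hpm hY hX f with h' | h' <;> rw [h'] at h
  · exact Or.inl (by exact_mod_cast h)
  · exact Or.inr (by exact_mod_cast h)

/-! ### The orbit formula and uniqueness -/

section Formula

variable (hG : IsOligomorphic G Ω) (hIND : IND G Ω 1) {X Y : GSet (stabClass G Ω)}

/-- The two-element subsets of the fibers, without the base point. -/
def toFiberPairs (f : Y →[G] X) : GSet.subsets hG hIND f 2 →[G] fiberPairs f where
  toFun p := ⟨p.1.2, by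
    rw [Set.ncard, p.2.1]
    rfl, fun y hy y' hy' => (p.2.2 y hy).trans (p.2.2 y' hy').symm⟩
  map_smul' _ _ := rfl

theorem toFiberPairs_bijective (f : Y →[G] X) :
    Function.Bijective (toFiberPairs hG hIND f) := by
  constructor
  · intro p p' h
    have h2 : p.1.2 = p'.1.2 := congrArg Subtype.val h
    obtain ⟨y, _, _, hy⟩ := Set.encard_eq_two.1 p.2.1
    have hyp : y ∈ p.1.2 := hy ▸ Or.inl rfl
    exact Subtype.ext (Prod.ext ((p.2.2 y hyp).symm.trans (p'.2.2 y (h2 ▸ hyp))) h2)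
  · rintro ⟨S, hS, hf⟩
    obtain ⟨a, b, hab, rfl⟩ := Set.ncard_eq_two.1 hS
    exact ⟨⟨(f a, {a, b}), Set.encard_pair hab, fun y hy => hf y hy a (Or.inl rfl)⟩, rfl⟩

/-- Each orbit of pairs contributes ±1, so the measure of the set of pairs has the parity of its
number of orbits. By 2μ(f^(2)) = μ(f)(μ(f) - 1) that measure is 0 if μ(f) = 1 and 1 if μ(f) = -1. -/
theorem Measure.IsRegular.val_eq {μ : Measure (stabClass G Ω) ℤ} (hμ : μ.IsRegular)
    (hY : Y.IsTransitive) (hX : X.IsTransitive) (f : Y →[G] X) :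
    μ.val hX f = (-1) ^ Nat.card (orbitRel.Quotient G (GSet.subsets hG hIND f 2)) := by
  classical
  have := Fintype.ofFinite (orbitRel.Quotient G (GSet.subsets hG hIND f 2))
  have h2 := μ.two_mul_val_subsets_two hG hIND f hX
  have hcast : ((μ.val hX (subsetsProj hG hIND f 2) : ℤ) : ZMod 2) =
      (Nat.card (orbitRel.Quotient G (GSet.subsets hG hIND f 2)) : ZMod 2) := by
    rw [(μ.isAdditive hX).sum_orb, Int.cast_sum, Nat.card_eq_fintype_card, ← Finset.card_univ,
      Finset.card_eq_sum_ones, Nat.cast_sum]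
    refine Finset.sum_congr rfl fun q _ => ?_
    rcases Int.isUnit_iff.1 (hμ (GSet.orb_isTransitive _ q) hX
      ((subsetsProj hG hIND f 2).comp (GSet.incl _ (orbitSub q)))) with h | h <;> rw [h] <;> rfl
  rcases Int.isUnit_iff.1 (hμ hY hX f) with h | h <;> rw [h] at h2 ⊢
  · have hb : μ.val hX (subsetsProj hG hIND f 2) = 0 := by omega
    rw [hb, Int.cast_zero, eq_comm, ZMod.natCast_eq_zero_iff_even] at hcast
    rw [hcast.neg_one_pow]
  · have hb : μ.val hX (subsetsProj hG hIND f 2) = 1 := by omega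
    rw [hb, Int.cast_one, eq_comm, ZMod.natCast_eq_one_iff_odd] at hcast
    rw [hcast.neg_one_pow]

theorem Measure.ext_of_transitive {E : Set (Subgroup G)} {k : Type*} [CommRing k]
    {μ μ' : Measure E k}
    (h : ∀ {X Y : GSet E} (_ : Y.IsTransitive) (hX : X.IsTransitive) (f : Y →[G] X),
      μ.val hX f = μ'.val hX f) : μ = μ' := by
  classical
  apply Measure.ext
  funext Y X hX f
  have := Fintype.ofFinite (orbitRel.Quotient G Y)
  rw [(μ.isAdditive hX).sum_orb, (μ'.isAdditive hX).sum_orb]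
  exact Finset.sum_congr rfl fun q _ => h (Y.orb_isTransitive q) hX _

end Formula

end Oligo

theorem mainTheorem9 {G Ω : Type u} [Group G] [MulAction G Ω]
    (hG : Oligo.IsOligomorphic G Ω)
    (hGEN : Oligo.GEN G Ω 1)
    (hIND : Oligo.IND G Ω 1)
    (hodd : Oligo.IsOdd G Ω) :
    (∃! μ : Oligo.Measure (Oligo.stabClass G Ω) ℤ, μ.IsRegular) ∧
    ∀ μ : Oligo.Measure (Oligo.stabClass G Ω) ℤ, μ.IsRegular →
      ∀ {Y X : Oligo.GSet (Oligo.stabClass G Ω)} (_ : Y.IsTransitive) (hX : X.IsTransitive)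
        (f : Y →[G] X),
        Finite (MulAction.orbitRel.Quotient G (Oligo.fiberPairs f)) ∧
        μ.val hX f = (-1) ^ Nat.card (MulAction.orbitRel.Quotient G (Oligo.fiberPairs f)) := by
  refine ⟨?_, fun μ hμ Y X hY hX f => ⟨?_, ?_⟩⟩
  · obtain ⟨μ, hμ⟩ := Oligo.exists_regular_measure hG hGEN hIND hodd
    refine ⟨μ, hμ, fun μ' hμ' => Oligo.Measure.ext_of_transitive fun hY hX f => ?_⟩
    rw [Oligo.Measure.IsRegular.val_eq hG hIND hμ hY hX f,
      Oligo.Measure.IsRegular.val_eq hG hIND hμ' hY hX f]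
  · exact Finite.of_surjective (Oligo.orbitMap (Oligo.toFiberPairs hG hIND f))
      (Oligo.orbitMap_surjective (Oligo.toFiberPairs_bijective hG hIND f).2)
  · rw [← Oligo.card_orbits_of_bijective (Oligo.toFiberPairs_bijective hG hIND f)]
    exact Oligo.Measure.IsRegular.val_eq hG hIND hμ hY hX f
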